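/- Let $X$ be an integral regular projective curve over a finite field $\mathbb{F}_q$ with $q$ elements, and let $g=\dim_{\mathbb{F}_q}H^1(X,\mathcal{O}_X)$ be its genus. For a closed point $P$ let $d(P)=[\kappa(P):\mathbb{F}_q]$; for an effective divisor $D=\sum_P n_P P$ (with $n_P\in\mathbb{Z}_{\ge 0}$, almost all zero) put $d(D)=\sum_P n_P\,d(P)$ and $N(D)=q^{d(D)}$. Let $$\zeta_X(s)=\sum_{D\ge 0}\frac{1}{N(D)^{s}}\quad(\operatorname{Re}s>1),\qquad \widehat\zeta_X(s)=t^{\,1-g}\,\zeta_X(s)\ \text{ with } t=q^{-s},$$ where the sum runs over all effective divisors of $X$, and put $$\widehat\zeta_X^{*}(1)=\lim_{s\to 1}\,(1-q^{1-s})\,\widehat\zeta_X(s),\qquad \widehat v_n=\widehat\zeta_X^{*}(1)\,\widehat\zeta_X(2)\cdots\widehat\zeta_X(n)\quad(n\ge 1),$$ the limit being taken within the half-plane $\operatorname{Re}s>1$. Then the series $\zeta_X(s)$ converges absolutely for $\operatorname{Re}s>1$, the limit $\widehat\zeta_X^{*}(1)$ exists, and, for fixed $X$ and $n\to\infty$,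 $$\widehat v_n=O\!\left(q^{(g-1)n(n+1)/2}\right).$$ -/

import Mathlib

open CategoryTheory AlgebraicGeometry Opposite Filter Topology Asymptotics

universe u

namespace CurveZeta

noncomputable section

variable {k : Type u} [Field k] {X : Scheme.{u}}

/-- An integral regular projective curve over the field `k`, given by its structure morphism:
an integral regular scheme of dimension one which is proper over `k`. (A curve which is proper
over a field is projective.) -/
structure IsRegularProjectiveCurve (f : X ⟶ Spec (CommRingCat.of k)) : Prop where
  isIntegral : IsIntegral X
  isProper : IsProper f
  isRegular : ∀ x : X, IsRegularLocalRing (X.presheaf.stalk x)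
  dim_eq_one : topologicalKrullDim X = 1

section Genus

/-- The ring homomorphism `k → Γ(X, U)` given by the structure morphism of `X` over `k`. -/
def scalars (f : X ⟶ Spec (CommRingCat.of k)) (U : X.Opens) : k →+* Γ(X, U) :=
  ((Scheme.ΓSpecIso (CommRingCat.of k)).inv ≫ f.appTop ≫
    X.presheaf.map (homOfLE (le_top : U ≤ ⊤)).op).hom

lemma map_scalars (f : X ⟶ Spec (CommRingCat.of k)) {U V : X.Opens} (i : V ⟶ U) (c : k) :
    (X.presheaf.map i.op).hom (scalars f U c) = scalars f V c := by
  have h : X.presheaf.map (homOfLE (le_top : U ≤ ⊤)).op ≫ X.presheaf.map i.op =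
      X.presheaf.map (homOfLE (le_top : V ≤ ⊤)).op := by
    rw [← Functor.map_comp]
    rfl
  simp only [scalars, ← h]
  rfl

/-- The sections of `𝒪_X` over `U`, as a `k`-module. -/
def sectionsModule (f : X ⟶ Spec (CommRingCat.of k)) (U : X.Opens) : ModuleCat.{u} k :=
  letI : Module k Γ(X, U) := (scalars f U).toModule
  ModuleCat.of k Γ(X, U)

/-- The restriction maps of `𝒪_X`, as `k`-linear maps. -/
def sectionsRes (f : X ⟶ Spec (CommRingCat.of k)) {U V : X.Opens} (i : V ⟶ U) :
    sectionsModule f U ⟶ sectionsModule f V :=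
  letI : Module k Γ(X, U) := (scalars f U).toModule
  letI : Module k Γ(X, V) := (scalars f V).toModule
  ModuleCat.ofHom
    { toFun := fun s => (X.presheaf.map i.op).hom s
      map_add' := fun s t => map_add _ s t
      map_smul' := fun c s => by
        change (X.presheaf.map i.op).hom (scalars f U c * s) =
          scalars f V c * (X.presheaf.map i.op).hom s
        rw [map_mul, map_scalars] }

/-- The presheaf of `k`-modules underlying `𝒪_X`. -/
def structurePresheaf (f : X ⟶ Spec (CommRingCat.of k)) :
    TopCat.Presheaf (ModuleCat.{u} k) X where
  obj U := sectionsModule f U.unop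
  map i := sectionsRes f i.unop
  map_id U := by
    ext s
    change (X.presheaf.map (𝟙 U)).hom s = s
    rw [X.presheaf.map_id]
    rfl
  map_comp i j := by
    ext s
    change (X.presheaf.map (i ≫ j)).hom s = (X.presheaf.map j).hom ((X.presheaf.map i).hom s)
    rw [X.presheaf.map_comp]
    rfl

/-- The structure sheaf `𝒪_X` as a sheaf of `k`-modules on the topological space `X`. -/
def structureSheaf (f : X ⟶ Spec (CommRingCat.of k)) :
    CategoryTheory.Sheaf (Opens.grothendieckTopology X) (ModuleCat.{u} k) where
  obj := structurePresheaf f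
  property := by
    have h := (TopCat.Presheaf.isSheaf_iff_isSheaf_comp (forget CommRingCat) X.presheaf).1
      X.IsSheaf
    exact (TopCat.Presheaf.isSheaf_iff_isSheaf_comp (forget (ModuleCat.{u} k))
      (structurePresheaf f)).2 h

/-- The sheaf cohomology `H¹(X, 𝒪_X)`, as the `Ext`-group from the constant sheaf `k` to `𝒪_X`
in the category of sheaves of `k`-modules; it is a `k`-module. -/
abbrev H1 (f : X ⟶ Spec (CommRingCat.of k)) : Type u :=
  Abelian.Ext.{u} ((constantSheaf (Opens.grothendieckTopology X) (ModuleCat.{u} k)).obj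
    (ModuleCat.of k k)) (structureSheaf f) 1

/-- The genus `g = dim_k H¹(X, 𝒪_X)`. -/
def genus (f : X ⟶ Spec (CommRingCat.of k)) : ℕ :=
  Module.finrank k (H1 f)

end Genus

variable (X) in
/-- The closed points of `X`. -/
def ClosedPoint : Type u := {P : X // IsClosed ({P} : Set X)}

variable (X) in
/-- Effective divisors: formal sums `∑ n_P P` over closed points with `n_P ∈ ℤ_{≥ 0}`, almost
all of them zero. -/
abbrev EffectiveDivisor : Type u := ClosedPoint X →₀ ℕ

/-- The degree `d(P) = [κ(P) : k]` of a closed point. -/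
def pointDegree (f : X ⟶ Spec (CommRingCat.of k)) (P : ClosedPoint X) : ℕ :=
  f.residueDegree P.1

/-- The degree `d(D) = ∑ n_P d(P)`. -/
def divisorDegree (f : X ⟶ Spec (CommRingCat.of k)) (D : EffectiveDivisor X) : ℕ :=
  D.sum fun P n => n * pointDegree f P

/-- The norm `N(D) = q ^ d(D)`, where `q` is the number of elements of `k`. -/
def divisorNorm (f : X ⟶ Spec (CommRingCat.of k)) (D : EffectiveDivisor X) : ℕ :=
  Nat.card k ^ divisorDegree f D

/-- The Artin zeta function `ζ_X(s) = ∑_{D ≥ 0} N(D)^{-s}`, for `Re s > 1`. -/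
def zeta (f : X ⟶ Spec (CommRingCat.of k)) (s : ℂ) : ℂ :=
  ∑' D : EffectiveDivisor X, 1 / (divisorNorm f D : ℂ) ^ s

/-- The completed zeta function `ζ̂_X(s) = t^{1-g} ζ_X(s)` with `t = q^{-s}`. -/
def completedZeta (f : X ⟶ Spec (CommRingCat.of k)) (s : ℂ) : ℂ :=
  ((Nat.card k : ℂ) ^ (-s)) ^ (1 - (genus f : ℤ)) * zeta f s

/-- The function `(1 - q^{1-s}) ζ̂_X(s)`, whose limit at `s = 1` is `ζ̂*_X(1)`. -/
def regularizedZeta (f : X ⟶ Spec (CommRingCat.of k)) (s : ℂ) : ℂ :=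
  (1 - (Nat.card k : ℂ) ^ (1 - s)) * completedZeta f s

/-- The value `ζ̂*_X(1) = lim_{s → 1} (1 - q^{1-s}) ζ̂_X(s)`, the limit being taken in the
half-plane `Re s > 1` on which `ζ_X` is defined. -/
def completedZetaStar (f : X ⟶ Spec (CommRingCat.of k)) : ℂ :=
  limUnder (𝓝[{s : ℂ | 1 < s.re}] 1) (regularizedZeta f)

/-- `v̂_n = ζ̂*_X(1) ζ̂_X(2) ⋯ ζ̂_X(n)` (for `n ≥ 1`). -/
def vHat (f : X ⟶ Spec (CommRingCat.of k)) (n : ℕ) : ℂ :=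
  completedZetaStar f * ∏ j ∈ Finset.Icc 2 n, completedZeta f (j : ℂ)

end

end CurveZeta

/-! With `t = q^{-s}` the zeta function is `∑ t^{d(D)}`, and the analytic claims rest on one
recurrence. On a suitable affine open `U`, let `a(n)` be the number of effective divisors of degree
`n`; then `a(n + m) = q^m a(n)` for some `m > 0` and all large `n`. Hence `a(n) = O(q^n)`, which
gives convergence, and `(1 - (qt)^m) ∑ a(n) t^n` is a polynomial, so the pole at `1/q` is at most
simple (`exists_tendsto_generatingSeries`). Only finitely many closed points lie outside `U`; their
series is continuous at `1/q` and enters as a factor (`exists_tendsto_of_sum`).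

The recurrence is obtained without Riemann–Roch. The ring `A = Γ(X, U)` is Dedekind and finite over
some `k[x]`, and effective divisors on `U` are its nonzero ideals. Degrees of coordinates over
`k[x]` filter `K = Frac A` by groups `V_j` with `K = A ⊕ V_0` and `x V_j = V_{j+1}`
(`exists_poleFiltration`). Put `Q = [V_1 : V_0]`. Multiplication by `x u`, with `u` congruent to `1`
at infinity, relates ideals of norm `ν` to ideals of norm `Q ν`. If the norm of `I` is large, then
`I⁻¹ + V_j = K` for the levels `j` needed, so the number of partners of `I` depends only on its norm
(`ncard_scaledIdeals`). Counting related pairs in two ways gives the recurrence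
(`exists_ncard_idealsOfNorm`).

For the growth, `ζ_X(j) = 1 + O(q^{-j})`, so the product of these values is bounded, while the
factors `q^{(g-1)j}` multiply to the asserted power up to a constant. The genus enters only through
this exponent. -/

namespace CurveZeta

/-! ### Counting in filtered abelian groups -/

section CardLemmas

variable {G : Type*} [AddCommGroup G]

/-- Since `V ⊆ L + M`, the second isomorphism theorem identifies `(L ∩ V)/(L ∩ M)` with `V/M`. This
is the substitute for Riemann–Roch: the second hypothesis plays the role of vanishing of `H¹`. -/
lemma card_inf_eq_card_inf_mul_relIndex (L M V : AddSubgroup G) (hMV : M ≤ V)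
    (hLM : ∀ v ∈ V, ∃ l ∈ L, v - l ∈ M) :
    Nat.card ↥(L ⊓ V) = Nat.card ↥(L ⊓ M) * M.relIndex V := by
  have h1 : (L ⊓ V) ⊔ M = V := by
    refine le_antisymm (sup_le inf_le_right hMV) fun v hv => ?_
    obtain ⟨l, hl, hvl⟩ := hLM v hv
    refine AddSubgroup.mem_sup.2 ⟨l, ⟨hl, ?_⟩, v - l, hvl, by abel⟩
    simpa using V.sub_mem hv (hMV hvl)
  have h2 : M ⊓ (L ⊓ V) = L ⊓ M := by
    rw [inf_comm, inf_assoc, inf_eq_right.2 hMV]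
  rw [← AddSubgroup.relIndex_bot_left, ← AddSubgroup.relIndex_bot_left,
    ← AddSubgroup.relIndex_mul_relIndex ⊥ (L ⊓ M) (L ⊓ V) bot_le (inf_le_inf le_rfl hMV),
    ← h2, AddSubgroup.inf_relIndex_right]
  congr 1
  conv_rhs => rw [← h1]
  rw [AddSubgroup.relIndex_sup_right]

lemma card_coset_inf (L M : AddSubgroup G) (y : G) (h : ∃ l ∈ L, y - l ∈ M) :
    Nat.card {l // l ∈ L ∧ l - y ∈ M} = Nat.card ↥(L ⊓ M) := by
  obtain ⟨l₀, hl₀, hy⟩ := h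
  refine Nat.card_congr
    { toFun := fun l => ⟨l.1 - l₀, L.sub_mem l.2.1 hl₀, ?_⟩
      invFun := fun l => ⟨l.1 + l₀, L.add_mem l.2.1 hl₀, ?_⟩
      left_inv := fun l => by simp
      right_inv := fun l => by simp }
  · have := M.add_mem l.2.2 hy
    simpa using this
  · have := M.sub_mem l.2.2 hy
    rwa [show l.1 - (y - l₀) = l.1 + l₀ - y by abel] at this

end CardLemmas

/-- A filtration of `K` by the order of the pole "at infinity", relative to the element `x` of
the subring `A`. -/
structure PoleFiltration (A K : Type*) [CommRing A] [Field K] [Algebra A K] (x : A) where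
  V : ℤ → AddSubgroup K
  mono' : ∀ j, V j ≤ V (j + 1)
  mem_iff' : ∀ j b, b ∈ V j ↔ algebraMap A K x * b ∈ V (j + 1)
  c : ℕ
  mul_mem : ∀ {i j a b}, a ∈ V i → b ∈ V j → a * b ∈ V (i + j + c)
  exists_mem : ∀ b, ∃ j, b ∈ V j
  eq_zero : ∀ a : A, algebraMap A K a ∈ V 0 → a = 0
  exists_sub_mem : ∀ b, ∃ a : A, b - algebraMap A K a ∈ V 0
  finite : {a : A | algebraMap A K a ∈ V 1}.Finite

/-! ### Inverse ideals and scaling of ideals -/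

section InverseIdeal

variable {A : Type*} (K : Type*) [CommRing A] [Field K] [Algebra A K]

/-- The additive group of all `b ∈ K` with `b I ⊆ A`. -/
def invIdeal (I : Ideal A) : AddSubgroup K where
  carrier := {b | ∀ i ∈ I, ∃ a : A, b * algebraMap A K i = algebraMap A K a}
  zero_mem' i _ := ⟨0, by simp⟩
  add_mem' {b b'} hb hb' i hi := by
    obtain ⟨a, ha⟩ := hb i hi
    obtain ⟨a', ha'⟩ := hb' i hi
    exact ⟨a + a', by rw [add_mul, ha, ha', map_add]⟩
  neg_mem' {b} hb i hi := by
    obtain ⟨a, ha⟩ := hb i hi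
    exact ⟨-a, by rw [neg_mul, ha, map_neg]⟩

variable {K}

lemma mem_invIdeal {I : Ideal A} {b : K} :
    b ∈ invIdeal K I ↔ ∀ i ∈ I, ∃ a : A, b * algebraMap A K i = algebraMap A K a := Iff.rfl

lemma algebraMap_mem_invIdeal (I : Ideal A) (a : A) : algebraMap A K a ∈ invIdeal K I :=
  fun i _ => ⟨a * i, by rw [map_mul]⟩

lemma mul_algebraMap_mem_invIdeal {I : Ideal A} {b : K} (hb : b ∈ invIdeal K I) (a : A) :
    b * algebraMap A K a ∈ invIdeal K I := fun i hi => by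
  obtain ⟨a', ha'⟩ := hb i hi
  exact ⟨a * a', by rw [map_mul, ← ha']; ring⟩

/-- `J = z I` inside `K`. -/
def IsScaled (z : K) (I J : Ideal A) : Prop :=
  (∀ i ∈ I, ∃ j ∈ J, z * algebraMap A K i = algebraMap A K j) ∧
    ∀ j ∈ J, ∃ i ∈ I, z * algebraMap A K i = algebraMap A K j

lemma IsScaled.mem_invIdeal_iff {z : K} {I J : Ideal A} (h : IsScaled z I J) (b : K) :
    b ∈ invIdeal K J ↔ z * b ∈ invIdeal K I := by
  constructor
  · intro hb i hi
    obtain ⟨j, hj, e⟩ := h.1 i hi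
    obtain ⟨a, ha⟩ := hb j hj
    exact ⟨a, by rw [← ha, ← e]; ring⟩
  · intro hb j hj
    obtain ⟨i, hi, e⟩ := h.2 j hj
    obtain ⟨a, ha⟩ := hb i hi
    exact ⟨a, by rw [← ha, ← e]; ring⟩

lemma IsScaled.inv {z : K} (hz : z ≠ 0) {I J : Ideal A} (h : IsScaled z I J) :
    IsScaled z⁻¹ J I := by
  constructor
  · intro j hj
    obtain ⟨i, hi, e⟩ := h.2 j hj
    exact ⟨i, hi, by rw [← e]; field_simp⟩
  · intro i hi
    obtain ⟨j, hj, e⟩ := h.1 i hi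
    exact ⟨j, hj, by rw [← e]; field_simp⟩

lemma IsScaled.trans {z w : K} {I J L : Ideal A} (h : IsScaled z I J) (h' : IsScaled w J L) :
    IsScaled (w * z) I L := by
  constructor
  · intro i hi
    obtain ⟨j, hj, e⟩ := h.1 i hi
    obtain ⟨l, hl, e'⟩ := h'.1 j hj
    exact ⟨l, hl, by rw [mul_assoc, e, e']⟩
  · intro l hl
    obtain ⟨j, hj, e'⟩ := h'.2 l hl
    obtain ⟨i, hi, e⟩ := h.2 j hj
    exact ⟨i, hi, by rw [mul_assoc, e, e']⟩

lemma IsScaled.mem {z : K} {I J : Ideal A} (h : IsScaled z I J) : z ∈ invIdeal K I :=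
  fun i hi => (h.1 i hi).imp fun _ ha => ha.2

/-- Together with `IsScaled.mem`, this turns counting the integral ideals `z I` into counting
elements `z` of `I⁻¹`. -/
lemma exists_isScaled {z : K} {I : Ideal A} (hz : z ∈ invIdeal K I) :
    ∃ J : Ideal A, IsScaled z I J := by
  refine ⟨{ carrier := {j | ∃ i ∈ I, z * algebraMap A K i = algebraMap A K j},
            zero_mem' := ⟨0, I.zero_mem, by simp⟩,
            add_mem' := ?_, smul_mem' := ?_ }, ?_, fun j hj => hj⟩
  · rintro a b ⟨i, hi, e⟩ ⟨i', hi', e'⟩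
    exact ⟨i + i', I.add_mem hi hi', by rw [map_add, mul_add, e, e', map_add]⟩
  · rintro c a ⟨i, hi, e⟩
    exact ⟨c * i, I.mul_mem_left c hi, by rw [smul_eq_mul, map_mul, map_mul, ← e]; ring⟩
  · intro i hi
    obtain ⟨a, ha⟩ := hz i hi
    exact ⟨a, ⟨i, hi, ha⟩, ha⟩

variable [IsFractionRing A K]

lemma IsScaled.ne_bot {z : K} (hz : z ≠ 0) {I J : Ideal A} (h : IsScaled z I J) (hI : I ≠ ⊥) :
    J ≠ ⊥ := by
  obtain ⟨i, hi, hi0⟩ := Submodule.exists_mem_ne_zero_of_ne_bot hI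
  obtain ⟨j, hj, e⟩ := h.1 i hi
  rintro rfl
  rw [Ideal.mem_bot] at hj
  subst hj
  rw [map_zero, mul_eq_zero] at e
  exact hi0 (IsFractionRing.injective A K (by simpa using e.resolve_left hz))

lemma IsScaled.unique {z : K} {I J J' : Ideal A} (h : IsScaled z I J) (h' : IsScaled z I J') :
    J = J' := by
  have aux : ∀ {J J' : Ideal A}, IsScaled z I J → IsScaled z I J' → J ≤ J' := by
    intro J J' h h' j hj
    obtain ⟨i, hi, e⟩ := h.2 j hj
    obtain ⟨j', hj', e'⟩ := h'.1 i hi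
    rwa [IsFractionRing.injective A K (e.symm.trans e')]
  exact le_antisymm (aux h h') (aux h' h)

variable [IsDedekindDomain A]

open scoped nonZeroDivisors in
lemma invIdeal_eq (I : Ideal A) (hI : I ≠ ⊥) :
    invIdeal K I = ((I : FractionalIdeal A⁰ K)⁻¹ : FractionalIdeal A⁰ K).coeToSubmodule.toAddSubgroup := by
  ext b
  rw [Submodule.mem_toAddSubgroup]
  change _ ↔ b ∈ (I : FractionalIdeal A⁰ K)⁻¹
  rw [FractionalIdeal.mem_inv_iff (FractionalIdeal.coeIdeal_ne_zero.2 hI), mem_invIdeal]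
  refine ⟨fun h y hy => ?_, fun h i hi => ?_⟩
  · obtain ⟨i, hi, rfl⟩ := (FractionalIdeal.mem_coeIdeal _).1 hy
    obtain ⟨a, ha⟩ := h i hi
    exact (FractionalIdeal.mem_one_iff _).2 ⟨a, ha.symm⟩
  · obtain ⟨a, ha⟩ := (FractionalIdeal.mem_one_iff _).1
      (h _ (FractionalIdeal.mem_coeIdeal_of_mem _ hi))
    exact ⟨a, ha.symm⟩

/-- A unit scaling an ideal to itself belongs to `A`. -/
lemma exists_eq_algebraMap_of_isScaled_self {z : K} {I : Ideal A} (hI : I ≠ ⊥)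
    (h : IsScaled z I I) : ∃ a : A, z = algebraMap A K a := by
  have hz : IsIntegral A z := by
    refine isIntegral_of_smul_mem_submodule (M := K)
      (N := Submodule.map (Algebra.linearMap A K) I) ?_ (IsNoetherian.noetherian I |>.map _) z ?_
    · intro hbot
      obtain ⟨i, hi, hi0⟩ := Submodule.exists_mem_ne_zero_of_ne_bot hI
      have : algebraMap A K i ∈ Submodule.map (Algebra.linearMap A K) I := ⟨i, hi, rfl⟩
      rw [hbot, Submodule.mem_bot] at this
      exact hi0 (IsFractionRing.injective A K (by simpa using this))
    · rintro _ ⟨i, hi, rfl⟩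
      obtain ⟨j, hj, e⟩ := h.1 i hi
      exact ⟨j, hj, e.symm⟩
  obtain ⟨a, ha⟩ := IsIntegrallyClosed.isIntegral_iff.1 hz
  exact ⟨a, ha.symm⟩

open scoped nonZeroDivisors in
-- Invertibility gives `I⁻¹ · I = 1 · 1`, whence `I⁻¹/A ≅ A/I`.
lemma relIndex_range_invIdeal (I : Ideal A) (hI : I ≠ ⊥) :
    (algebraMap A K).toAddMonoidHom.range.relIndex (invIdeal K I) = Nat.card (A ⧸ I) := by
  have hI' : (I : FractionalIdeal A⁰ K) ≠ 0 := FractionalIdeal.coeIdeal_ne_zero.2 hI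
  have hle : (I : FractionalIdeal A⁰ K) ≤ 1 := FractionalIdeal.coeIdeal_le_one
  have hle' : (1 : FractionalIdeal A⁰ K) ≤ (I : FractionalIdeal A⁰ K)⁻¹ := by
    rw [FractionalIdeal.le_inv_comm (one_ne_zero' (FractionalIdeal A⁰ K)) hI', inv_one]
    exact hle
  have e := FractionalIdeal.quotientEquiv (I : FractionalIdeal A⁰ K)⁻¹ 1 1 (I : FractionalIdeal A⁰ K)
    (by rw [inv_mul_cancel₀ hI', one_mul]) hle' hle hI' (inv_ne_zero hI')
  have h1 : (algebraMap A K).toAddMonoidHom.range.relIndex (invIdeal K I) =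
      Nat.card (((I : FractionalIdeal A⁰ K)⁻¹ : FractionalIdeal A⁰ K) ⧸ (1 : FractionalIdeal A⁰ K).coeToSubmodule.comap
        ((I : FractionalIdeal A⁰ K)⁻¹ : FractionalIdeal A⁰ K).coeToSubmodule.subtype) := by
    rw [invIdeal_eq I hI]
    have : (algebraMap A K).toAddMonoidHom.range =
        (1 : FractionalIdeal A⁰ K).coeToSubmodule.toAddSubgroup := by
      ext b
      rw [Submodule.mem_toAddSubgroup]
      change _ ↔ b ∈ (1 : FractionalIdeal A⁰ K)
      rw [FractionalIdeal.mem_one_iff]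
      rfl
    rw [this]
    rfl
  rw [h1, Nat.card_congr e.toEquiv]
  let φ : A →ₗ[A] (1 : FractionalIdeal A⁰ K).coeToSubmodule :=
    (Algebra.linearMap A K).codRestrict (1 : FractionalIdeal A⁰ K).coeToSubmodule
      fun a => (FractionalIdeal.mem_one_iff _).2 ⟨a, rfl⟩
  let ψ := ((I : FractionalIdeal A⁰ K).coeToSubmodule.comap
    (1 : FractionalIdeal A⁰ K).coeToSubmodule.subtype).mkQ.comp φ
  have hψ : Function.Surjective ψ := by
    refine (Submodule.mkQ_surjective _).comp ?_
    rintro ⟨b, hb⟩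
    obtain ⟨a, rfl⟩ := (FractionalIdeal.mem_one_iff _).1 hb
    exact ⟨a, rfl⟩
  have hker : LinearMap.ker ψ = I := by
    rw [LinearMap.ker_comp, Submodule.ker_mkQ]
    ext a
    change algebraMap A K a ∈ (I : FractionalIdeal A⁰ K) ↔ _
    refine ⟨fun ha => ?_, fun ha => FractionalIdeal.mem_coeIdeal_of_mem _ ha⟩
    obtain ⟨i, hi, e⟩ := (FractionalIdeal.mem_coeIdeal _).1 ha
    rwa [← IsFractionRing.injective A K e]
  exact (Nat.card_congr
    ((Submodule.quotEquivOfEq _ _ hker.symm).trans (ψ.quotKerEquivOfSurjective hψ)).toEquiv).symm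

end InverseIdeal

/-! ### Indices in a pole filtration -/

namespace PoleFiltration

variable {A K : Type*} [CommRing A] [Field K] [Algebra A K] {x : A} (F : PoleFiltration A K x)

lemma mono {i j : ℤ} (h : i ≤ j) : F.V i ≤ F.V j := by
  obtain ⟨n, rfl⟩ := Int.le.dest h
  induction n with
  | zero => simp
  | succ n ih =>
    have := F.mono' (i + n)
    push_cast
    rw [← add_assoc]
    exact (ih (by omega)).trans this

/-- The index of one step of the filtration. -/
noncomputable def step : ℕ := (F.V 0).relIndex (F.V 1)

/-- The subring `A` as an additive subgroup of `K`. -/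
abbrev base (A K : Type*) [CommRing A] [Field K] [Algebra A K] : AddSubgroup K :=
  (algebraMap A K).toAddMonoidHom.range

lemma base_inf_V_zero : base A K ⊓ F.V 0 = ⊥ := by
  rw [eq_bot_iff]
  rintro _ ⟨⟨a, rfl⟩, ha⟩
  have : a = 0 := F.eq_zero a ha
  simp [this]

lemma exists_base (b : K) : ∃ l ∈ base A K, b - l ∈ F.V 0 := by
  obtain ⟨a, ha⟩ := F.exists_sub_mem b
  exact ⟨_, ⟨a, rfl⟩, ha⟩

lemma card_base_inf_V_one : Nat.card ↥(base A K ⊓ F.V 1) = F.step := by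
  rw [card_inf_eq_card_inf_mul_relIndex (base A K) (F.V 0) (F.V 1) (F.mono (by norm_num))
    fun v _ => F.exists_base v, F.base_inf_V_zero]
  simp [step]

lemma finite_base_inf_V_one : Finite ↥(base A K ⊓ F.V 1) := by
  have h : ((base A K ⊓ F.V 1 : AddSubgroup K) : Set K) ⊆
      algebraMap A K '' {a : A | algebraMap A K a ∈ F.V 1} := by
    rintro _ ⟨⟨a, rfl⟩, ha⟩
    exact ⟨a, ha, rfl⟩
  exact ((F.finite.image _).subset h).to_subtype

lemma step_ne_zero : F.step ≠ 0 := by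
  have := F.finite_base_inf_V_one
  rw [← F.card_base_inf_V_one]
  exact Nat.card_pos.ne'

variable (hx : algebraMap A K x ≠ 0)
include hx

/-- Multiplication by `x` is an automorphism of the group `K` that carries `V_j` onto `V_{j+1}`, so
all steps have the same index. -/
lemma relIndex_succ_succ (j : ℤ) :
    (F.V (j + 1)).relIndex (F.V (j + 1 + 1)) = (F.V j).relIndex (F.V (j + 1)) := by
  have h : ∀ j, (F.V (j + 1)) = (F.V j).map (AddMonoidHom.mulLeft (algebraMap A K x)) := by
    intro j
    ext b
    rw [AddSubgroup.mem_map]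
    constructor
    · intro hb
      refine ⟨(algebraMap A K x)⁻¹ * b, ?_, ?_⟩
      · rw [F.mem_iff', mul_inv_cancel_left₀ hx]
        exact hb
      · exact mul_inv_cancel_left₀ hx b
    · rintro ⟨b, hb, rfl⟩
      exact (F.mem_iff' j b).1 hb
  calc _ = ((F.V j).map (AddMonoidHom.mulLeft (algebraMap A K x))).relIndex
        ((F.V (j + 1)).map (AddMonoidHom.mulLeft (algebraMap A K x))) := by rw [← h, ← h]
    _ = _ := AddSubgroup.relIndex_map_map_of_injective _ _ (mul_right_injective₀ hx)

lemma relIndex_succ (j : ℤ) : (F.V j).relIndex (F.V (j + 1)) = F.step := by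
  induction j using Int.induction_on with
  | zero => simp [step]
  | succ n ih => rw [F.relIndex_succ_succ hx, ih]
  | pred n ih =>
    rw [← ih, ← F.relIndex_succ_succ hx]
    simp

lemma relIndex_add (j : ℤ) (n : ℕ) : (F.V j).relIndex (F.V (j + n)) = F.step ^ n := by
  induction n with
  | zero => simp
  | succ n ih =>
    rw [← AddSubgroup.relIndex_mul_relIndex _ (F.V (j + n)) _ (F.mono (by omega))
      (F.mono (by push_cast; omega)), ih, pow_succ]
    push_cast
    rw [← add_assoc, F.relIndex_succ hx]

lemma relIndex_eq {i j : ℤ} (n : ℕ) (h : i + n = j) :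
    (F.V i).relIndex (F.V j) = F.step ^ n := by
  rw [← h, F.relIndex_add hx]

lemma mem_iff_zpow (e j : ℤ) (b : K) :
    b ∈ F.V j ↔ algebraMap A K x ^ e * b ∈ F.V (j + e) := by
  induction e using Int.induction_on with
  | zero => simp
  | succ n ih => 
    rw [ih, F.mem_iff', ← mul_assoc, ← zpow_one_add₀ hx, add_comm 1, add_assoc]
  | pred n ih => 
    rw [ih, F.mem_iff' (j + (-n - 1)), ← mul_assoc, ← zpow_one_add₀ hx,
      show (1 + (-n - 1) : ℤ) = -n by ring, show j + (-n - 1 : ℤ) + 1 = j + -n by ring]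

omit hx

/-! ### Elements congruent to one at infinity -/

section Units

lemma mul_mem_V {m b : K} {j : ℤ} (hm : m ∈ F.V (-(F.c + 1))) (hb : b ∈ F.V j) :
    m * b ∈ F.V (j - 1) := by
  have := F.mul_mem hm hb
  rwa [show -((F.c : ℤ) + 1) + j + F.c = j - 1 by ring] at this

/-- The elements that are congruent to `1` at infinity. -/
def IsOneUnit (u : K) : Prop := u - 1 ∈ F.V (-(F.c + 1))

variable {F}

/-- Multiplication by `u - 1` lowers the level by one, so `u b` and `b` differ by a lower-order
term. For the forward direction, `b` lies in some `V i`, and `b = u b - (u - 1) b` brings the level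
down to `j` one step at a time. -/
lemma IsOneUnit.mem_iff {u : K} (hu : F.IsOneUnit u) (j : ℤ) (b : K) :
    u * b ∈ F.V j ↔ b ∈ F.V j := by
  have key : ∀ {i b}, b ∈ F.V i → (u - 1) * b ∈ F.V (i - 1) := fun hb => F.mul_mem_V hu hb
  constructor
  · intro hb
    obtain ⟨i, hi⟩ := F.exists_mem b
    have aux : ∀ n : ℕ, b ∈ F.V (j + n) → b ∈ F.V j := by
      intro n
      induction n with
      | zero => simp
      | succ n ih =>
        intro h
        refine ih ?_
        have h1 := key h
        have h2 : u * b - (u - 1) * b ∈ F.V (j + n) :=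
          (F.V _).sub_mem (F.mono (by omega) hb) (F.mono (by push_cast; omega) h1)
        rwa [show u * b - (u - 1) * b = b by ring] at h2
    exact aux (i - j).toNat (F.mono (by omega) hi)
  · intro hb
    have h2 : b + (u - 1) * b ∈ F.V j := (F.V _).add_mem hb (F.mono (by omega) (key hb))
    rwa [show b + (u - 1) * b = u * b by ring] at h2

lemma IsOneUnit.ne_zero [IsDomain A] {u : K} (hu : F.IsOneUnit u) : u ≠ 0 := by
  rintro rfl
  have h : (algebraMap A K 1) ∈ F.V 0 := by
    have := (F.V _).neg_mem (F.mono (show -((F.c : ℤ) + 1) ≤ 0 by omega) hu)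
    simpa using this
  exact one_ne_zero (F.eq_zero 1 h)

lemma IsOneUnit.mul {u v : K} (hu : F.IsOneUnit u) (hv : F.IsOneUnit v) : F.IsOneUnit (u * v) := by
  have h := (F.V _).add_mem ((hu.mem_iff _ _).2 hv) hu
  rwa [show u * (v - 1) + (u - 1) = u * v - 1 by ring] at h

lemma IsOneUnit.inv [IsDomain A] {u : K} (hu : F.IsOneUnit u) : F.IsOneUnit u⁻¹ := by
  rw [IsOneUnit, ← hu.mem_iff, mul_sub, mul_inv_cancel₀ hu.ne_zero, mul_one, ← neg_sub]
  exact (F.V _).neg_mem hu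

/-- This rigidity, a consequence of `A ∩ V_0 = 0`, is what makes distinct scaling factors produce
distinct ideals. -/
lemma IsOneUnit.eq_one {a : A} (ha : F.IsOneUnit (algebraMap A K a)) : a = 1 := by
  have h : algebraMap A K (a - 1) ∈ F.V 0 := by
    rw [map_sub, map_one]
    exact F.mono (by omega) ha
  exact sub_eq_zero.1 (F.eq_zero _ h)

end Units

lemma exists_invIdeal_zero (I : Ideal A) (b : K) : ∃ l ∈ invIdeal K I, b - l ∈ F.V 0 := by
  obtain ⟨a, ha⟩ := F.exists_sub_mem b
  exact ⟨_, algebraMap_mem_invIdeal I a, ha⟩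

/-- The ideals equal to `I`, up to scaling by `x ^ e` and an element congruent to `1`. -/
def scaledIdeals (F : PoleFiltration A K x) (e : ℤ) (I : Ideal A) : Set (Ideal A) :=
  {J | ∃ u, F.IsOneUnit u ∧ IsScaled (algebraMap A K x ^ e * u) I J}

include hx in
lemma mem_scaledIdeals_comm [IsDomain A] {e : ℤ} {I J : Ideal A} :
    J ∈ F.scaledIdeals e I ↔ I ∈ F.scaledIdeals (-e) J := by
  have aux : ∀ {e : ℤ} {I J : Ideal A}, J ∈ F.scaledIdeals e I → I ∈ F.scaledIdeals (-e) J := by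
    rintro e I J ⟨u, hu, h⟩
    refine ⟨u⁻¹, hu.inv, ?_⟩
    rw [zpow_neg, ← mul_inv]
    exact h.inv (mul_ne_zero (zpow_ne_zero _ hx) hu.ne_zero)
  exact ⟨aux, fun h => by simpa using aux h⟩

/-! ### Norms of ideals and the double count -/

section Norm

variable [IsFractionRing A K] [IsDedekindDomain A]

/-- As `A ⊆ I⁻¹` and `K = A ⊕ V_0`, also `I⁻¹ = A ⊕ (I⁻¹ ∩ V_0)`; the second summand therefore
represents `I⁻¹/A`. -/
lemma card_invIdeal_inf_V_zero {I : Ideal A} (hI : I ≠ ⊥) :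
    Nat.card ↥(invIdeal K I ⊓ F.V 0) = Nat.card (A ⧸ I) := by
  rw [inf_comm, card_inf_eq_card_inf_mul_relIndex (F.V 0) (base A K) (invIdeal K I),
    relIndex_range_invIdeal I hI, inf_comm, F.base_inf_V_zero]
  · simp
  · rintro _ ⟨a, rfl⟩
    exact algebraMap_mem_invIdeal I a
  · intro v _
    obtain ⟨a, ha⟩ := F.exists_sub_mem v
    exact ⟨_, ha, by rw [sub_sub_cancel]; exact ⟨a, rfl⟩⟩

include hx

/-- The inverse of an ideal of large norm is dense at infinity. -/
lemma exists_invIdeal_of_lt (j : ℤ) : ∃ T : ℕ, ∀ I : Ideal A, I ≠ ⊥ → T < Nat.card (A ⧸ I) →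
    ∀ y : K, ∃ l ∈ invIdeal K I, y - l ∈ F.V j := by
  -- A nonzero `b ∈ I⁻¹ ∩ V_{-R}` suffices: approximate `y / b` by `a ∈ A` up to `V_0`; then `b a`
  -- approximates `y` up to `V_{c-R} ⊆ V_j`.
  set R := (F.c - j).toNat with hR
  refine ⟨F.step ^ R, fun I hI hT y => ?_⟩
  have hrel : (F.V (-R)).relIndex (F.V 0) = F.step ^ R := F.relIndex_eq hx R (by simp)
  -- Pigeonhole: `I⁻¹ ∩ V_0` has more elements than `V_0/V_{-R}`.
  have hne : invIdeal K I ⊓ F.V (-R) ≠ ⊥ := by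
    intro hbot
    have h1 : (invIdeal K I ⊓ F.V (-R)).relIndex (invIdeal K I ⊓ F.V 0) = Nat.card (A ⧸ I) := by
      rw [hbot, AddSubgroup.relIndex_bot_left, F.card_invIdeal_inf_V_zero hI]
    have h2 : F.V (-R) ⊓ (invIdeal K I ⊓ F.V 0) = invIdeal K I ⊓ F.V (-R) := by
      rw [inf_comm, inf_assoc, inf_eq_right.2 (F.mono (by simp))]
    rw [← h2, AddSubgroup.inf_relIndex_right] at h1
    have h3 := AddSubgroup.relIndex_le_of_le_right (H := F.V (-R)) (K := invIdeal K I ⊓ F.V 0)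
      (L := F.V 0) inf_le_right (by rw [hrel]; exact pow_ne_zero _ F.step_ne_zero)
    rw [hrel, h1] at h3
    exact absurd h3 (not_le.2 hT)
  obtain ⟨⟨b, hb⟩, hb0⟩ := AddSubgroup.ne_bot_iff_exists_ne_zero.1 hne
  replace hb0 : b ≠ 0 := fun h => hb0 (Subtype.ext h)
  obtain ⟨a, ha⟩ := F.exists_sub_mem (y / b)
  refine ⟨b * algebraMap A K a, mul_algebraMap_mem_invIdeal hb.1 a, ?_⟩
  have := F.mono (show -(R : ℤ) + 0 + F.c ≤ j by omega) (F.mul_mem hb.2 ha)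
  rwa [mul_sub, mul_div_cancel₀ _ hb0] at this

lemma ne_bot_of_mem_scaledIdeals {e : ℤ} {I J : Ideal A} (hI : I ≠ ⊥)
    (h : J ∈ F.scaledIdeals e I) : J ≠ ⊥ := by
  obtain ⟨u, hu, h⟩ := h
  exact h.ne_bot (mul_ne_zero (zpow_ne_zero _ hx) hu.ne_zero) hI

/-- Multiplication by the scaling factor `x^e u` carries `J⁻¹ ∩ V_0` bijectively onto `I⁻¹ ∩ V_e`,
because `u` preserves every level. -/
lemma card_quotient_of_mem_scaledIdeals {e : ℤ} {I J : Ideal A} (hI : I ≠ ⊥)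
    (h : J ∈ F.scaledIdeals e I) :
    Nat.card (A ⧸ J) = Nat.card ↥(invIdeal K I ⊓ F.V e) := by
  have hJ := F.ne_bot_of_mem_scaledIdeals hx hI h
  obtain ⟨u, hu, h⟩ := h
  have hz : algebraMap A K x ^ e * u ≠ 0 := mul_ne_zero (zpow_ne_zero _ hx) hu.ne_zero
  rw [← F.card_invIdeal_inf_V_zero hJ]
  have key : ∀ b, b ∈ invIdeal K J ⊓ F.V 0 ↔
      algebraMap A K x ^ e * u * b ∈ invIdeal K I ⊓ F.V e := by
    intro b
    rw [AddSubgroup.mem_inf, AddSubgroup.mem_inf, h.mem_invIdeal_iff, mul_assoc,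
      ← hu.mem_iff, F.mem_iff_zpow hx e 0, zero_add]
  exact Nat.card_congr (Equiv.subtypeEquiv (Equiv.mulLeft₀ _ hz) key)

/-- The ideals `x^e u I` correspond to the elements `l = x^e u` of `I⁻¹` congruent to `x^e` modulo
`V_{e-(c+1)}`. By density this coset has as many elements as `I⁻¹ ∩ V_{e-(c+1)}`, which is `[V_0 :
V_{e-(c+1)}]` times smaller than `I⁻¹ ∩ V_0`. -/
lemma ncard_scaledIdeals {e : ℤ} {I : Ideal A} (hI : I ≠ ⊥) (n : ℕ)
    (hn : e - (F.c + 1) + n = 0)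
    (hd : ∀ y : K, ∃ l ∈ invIdeal K I, y - l ∈ F.V (e - (F.c + 1))) :
    (F.scaledIdeals e I).ncard * F.step ^ n = Nat.card (A ⧸ I) := by
  have hxe := zpow_ne_zero e hx
  rw [← F.card_invIdeal_inf_V_zero hI, card_inf_eq_card_inf_mul_relIndex (invIdeal K I)
    (F.V (e - (F.c + 1))) (F.V 0) (F.mono (by omega)) (fun v _ => hd v), F.relIndex_eq hx n hn,
    ← card_coset_inf _ _ _ (hd (algebraMap A K x ^ e))]
  congr 1
  have hone : ∀ l : K, l - algebraMap A K x ^ e ∈ F.V (e - (F.c + 1)) ↔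
      F.IsOneUnit ((algebraMap A K x ^ e)⁻¹ * l) := by
    intro l
    rw [IsOneUnit, F.mem_iff_zpow hx e (-(F.c + 1)), mul_sub, mul_inv_cancel_left₀ hxe, mul_one,
      neg_add_eq_sub]
  have hex : ∀ l : {l // l ∈ invIdeal K I ∧ l - algebraMap A K x ^ e ∈ F.V (e - (F.c + 1))},
      ∃ J, IsScaled l.1 I J := fun l => exists_isScaled l.2.1
  choose g hg using hex
  rw [← Nat.card_coe_set_eq]
  refine (Nat.card_congr (Equiv.ofBijective (fun l => (⟨g l, (algebraMap A K x ^ e)⁻¹ * l.1,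
    (hone _).1 l.2.2, by rw [mul_inv_cancel_left₀ hxe]; exact hg l⟩ : F.scaledIdeals e I))
    ⟨?_, ?_⟩)).symm
  · intro l l' hll
    have hll : g l = g l' := congrArg Subtype.val hll
    have hu := (hone _).1 l.2.2
    have hu' := (hone _).1 l'.2.2
    have hl : l.1 ≠ 0 := fun h => hu.ne_zero (by rw [h, mul_zero])
    have hl' : l'.1 ≠ 0 := fun h => hu'.ne_zero (by rw [h, mul_zero])
    have hs : IsScaled (l'.1⁻¹ * l.1) I I := by
      have h1 := hg l
      have h2 := (hg l').inv hl'
      rw [hll] at h1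
      exact h1.trans h2
    obtain ⟨a, ha⟩ := exists_eq_algebraMap_of_isScaled_self hI hs
    have h1 := hu'.inv.mul hu
    rw [show ((algebraMap A K x ^ e)⁻¹ * l'.1)⁻¹ * ((algebraMap A K x ^ e)⁻¹ * l.1) = l'.1⁻¹ * l.1 by
      field_simp, ha] at h1
    rw [h1.eq_one, map_one] at ha
    exact Subtype.ext (inv_mul_eq_one₀ hl' |>.1 ha).symm
  · rintro ⟨J, u, hu, hJ⟩
    refine ⟨⟨algebraMap A K x ^ e * u, hJ.mem, ?_⟩, Subtype.ext ?_⟩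
    · rw [hone, inv_mul_cancel_left₀ hxe]
      exact hu
    · exact (hg _).unique hJ

/-- The set of ideals of norm `ν`. -/
def _root_.CurveZeta.idealsOfNorm (A : Type*) [CommRing A] (ν : ℕ) : Set (Ideal A) :=
  {I | I ≠ ⊥ ∧ Nat.card (A ⧸ I) = ν}

include F

/-- Multiplication by a nonzero `h ∈ I` embeds `I⁻¹ ∩ V_0` into the finite group `A ∩ V_n`. -/
lemma finite_quotient {I : Ideal A} (hI : I ≠ ⊥) : Finite (A ⧸ I) := by
  obtain ⟨h, hhI, hh⟩ := Submodule.exists_mem_ne_zero_of_ne_bot hI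
  have hh' : algebraMap A K h ≠ 0 := by simpa using hh
  obtain ⟨j, hj⟩ := F.exists_mem (algebraMap A K h)
  set n := (j + F.c).toNat
  have hfin : Finite ↥(base A K ⊓ F.V n) := by
    refine Nat.finite_of_card_ne_zero ?_
    rw [card_inf_eq_card_inf_mul_relIndex (base A K) (F.V 0) (F.V n) (F.mono (by omega))
      fun v _ => F.exists_base v, F.base_inf_V_zero, F.relIndex_eq hx n (by simp)]
    simpa using fun h => absurd h F.step_ne_zero
  have key : ∀ b : ↥(invIdeal K I ⊓ F.V 0), b.1 * algebraMap A K h ∈ base A K ⊓ F.V n := by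
    rintro ⟨b, hb, hb'⟩
    obtain ⟨a, ha⟩ := hb h hhI
    refine ⟨⟨a, ha.symm⟩, ?_⟩
    exact F.mono (by omega) (F.mul_mem hb' hj)
  have : Finite ↥(invIdeal K I ⊓ F.V 0) := by
    refine Finite.of_injective (fun b => (⟨_, key b⟩ : ↥(base A K ⊓ F.V n))) ?_
    intro b b' hbb
    exact Subtype.ext (mul_left_injective₀ hh' (congrArg Subtype.val hbb))
  refine Nat.finite_of_card_ne_zero ?_
  rw [← F.card_invIdeal_inf_V_zero hI]
  exact Nat.card_pos.ne'

/-- Modulo an ideal of norm `ν`, two of the powers `x^0, …, x^ν` agree, so the product `h ≠ 0` of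
their differences lies in every such ideal. Ideals containing `h` come from the finite ring `A/(h)`.
-/
lemma finite_idealsOfNorm (hinj : Function.Injective fun n : ℕ => x ^ n) (ν : ℕ) :
    (idealsOfNorm A ν).Finite := by
  classical
  set h : A := ∏ i ∈ Finset.range (ν + 1), ∏ j ∈ (Finset.range (ν + 1)).erase i,
    (x ^ i - x ^ j) with hh
  have hh0 : h ≠ 0 := by
    refine Finset.prod_ne_zero_iff.2 fun i _ => Finset.prod_ne_zero_iff.2 fun j hj => ?_
    rw [sub_ne_zero]
    exact fun e => (Finset.mem_erase.1 hj).1 (hinj e).symm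
  have hmem : ∀ I ∈ idealsOfNorm A ν, Ideal.span {h} ≤ I := by
    rintro I ⟨hI, hc⟩
    have := F.finite_quotient hx hI
    have := Fintype.ofFinite (A ⧸ I)
    rw [Nat.card_eq_fintype_card] at hc
    obtain ⟨i, hi, j, hj, hij, e⟩ := Finset.exists_ne_map_eq_of_card_lt_of_maps_to
      (s := Finset.range (ν + 1)) (t := (Finset.univ : Finset (A ⧸ I)))
      (by simp [hc]) (f := fun n => Ideal.Quotient.mk I (x ^ n)) (fun _ _ => Finset.mem_univ _)
    rw [Ideal.span_singleton_le_iff_mem]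
    refine I.mem_of_dvd ((Finset.dvd_prod_of_mem _ (Finset.mem_erase.2 ⟨hij.symm, hj⟩)).trans
      (Finset.dvd_prod_of_mem _ hi)) (Ideal.Quotient.eq.1 e)
  have hspan : Ideal.span {h} ≠ (⊥ : Ideal A) := by simpa using hh0
  have := F.finite_quotient hx hspan
  have : Finite (Ideal (A ⧸ Ideal.span {h})) := Finite.of_injective _ SetLike.coe_injective
  refine (Set.finite_range (Ideal.comap (Ideal.Quotient.mk (Ideal.span {h})))).subset ?_
  intro I hI
  refine ⟨I.map (Ideal.Quotient.mk _), ?_⟩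
  rw [Ideal.comap_map_of_surjective _ Ideal.Quotient.mk_surjective]
  exact sup_eq_left.2 ((Ideal.mk_ker (I := Ideal.span {h})).le.trans (hmem I hI))

/-- Eventually, the number of ideals is multiplied by the step when the norm is. -/
theorem exists_ncard_idealsOfNorm (hinj : Function.Injective fun n : ℕ => x ^ n) :
    ∃ T : ℕ, ∀ ν, T < ν →
      (idealsOfNorm A (F.step * ν)).ncard = F.step * (idealsOfNorm A ν).ncard := by
  classical
  -- The deepest level at which density is needed, namely that of `ncard_scaledIdeals` for `e = -1`.
  obtain ⟨T, hT⟩ := F.exists_invIdeal_of_lt (A := A) hx (-1 - (F.c + 1))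
  refine ⟨T, fun ν hν => ?_⟩
  have hQ : 0 < F.step := Nat.pos_of_ne_zero F.step_ne_zero
  have hν0 : ν ≠ 0 := by omega
  have hS := F.finite_idealsOfNorm hx hinj ν
  have hS' := F.finite_idealsOfNorm hx hinj (F.step * ν)
  have hd : ∀ {I : Ideal A}, I ≠ ⊥ → T < Nat.card (A ⧸ I) → ∀ {j : ℤ}, -1 - (F.c + 1) ≤ j →
      ∀ y : K, ∃ l ∈ invIdeal K I, y - l ∈ F.V j := fun hI hT' j hj y =>
    (hT _ hI hT' y).imp fun l hl => ⟨hl.1, F.mono hj hl.2⟩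
  have h1 : ∀ I ∈ idealsOfNorm A ν, F.scaledIdeals 1 I ⊆ idealsOfNorm A (F.step * ν) := by
    rintro I ⟨hI, hc⟩ J hJ
    refine ⟨F.ne_bot_of_mem_scaledIdeals hx hI hJ, ?_⟩
    rw [F.card_quotient_of_mem_scaledIdeals hx hI hJ,
      card_inf_eq_card_inf_mul_relIndex (invIdeal K I) (F.V 0) (F.V 1) (F.mono (by omega))
      (fun v _ => F.exists_invIdeal_zero I v), F.card_invIdeal_inf_V_zero hI, hc, mul_comm]
    rfl
  have h2 : ∀ J ∈ idealsOfNorm A (F.step * ν), F.scaledIdeals (-1) J ⊆ idealsOfNorm A ν := by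
    rintro J ⟨hJ, hc⟩ I hI
    refine ⟨F.ne_bot_of_mem_scaledIdeals hx hJ hI, ?_⟩
    have := card_inf_eq_card_inf_mul_relIndex (invIdeal K J) (F.V (-1)) (F.V 0)
      (F.mono (by omega)) (fun v _ => hd hJ (by rw [hc]; nlinarith) (by omega) v)
    rw [F.card_invIdeal_inf_V_zero hJ, F.relIndex_eq hx 1 (by norm_num), pow_one, hc, mul_comm,
      ← F.card_quotient_of_mem_scaledIdeals hx hJ hI] at this
    exact (Nat.eq_of_mul_eq_mul_right hQ this).symm
  have c1 : ∀ I ∈ idealsOfNorm A ν, (F.scaledIdeals 1 I).ncard * F.step ^ F.c = ν := by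
    rintro I ⟨hI, hc⟩
    rw [F.ncard_scaledIdeals hx hI F.c (by omega) (hd hI (by omega) (by omega)), hc]
  have c2 : ∀ J ∈ idealsOfNorm A (F.step * ν),
      (F.scaledIdeals (-1) J).ncard * F.step ^ (F.c + 2) = F.step * ν := by
    rintro J ⟨hJ, hc⟩
    rw [F.ncard_scaledIdeals hx hJ (F.c + 2) (by push_cast; omega)
      (hd hJ (by rw [hc]; nlinarith) (by omega)), hc]
  -- With `Q` the step, each `I` has `ν / Q^c` partners `J`, and each `J` has `Q ν / Q^(c+2)`
  -- partners `I`; the ratio is `Q`.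
  have hcount := Finset.sum_card_bipartiteAbove_eq_sum_card_bipartiteBelow
    (s := hS.toFinset) (t := hS'.toFinset) (fun I J => J ∈ F.scaledIdeals 1 I)
  have e1 : ∀ I ∈ hS.toFinset, (Finset.bipartiteAbove (fun I J => J ∈ F.scaledIdeals 1 I)
      hS'.toFinset I).card * F.step ^ F.c = ν := by
    intro I hI
    rw [Set.Finite.mem_toFinset] at hI
    refine Eq.trans ?_ (c1 I hI)
    rw [← Set.ncard_coe_finset]
    congr 2
    ext J
    simpa [Finset.bipartiteAbove] using fun h => h1 I hI h
  have e2 : ∀ J ∈ hS'.toFinset, (Finset.bipartiteBelow (fun I J => J ∈ F.scaledIdeals 1 I)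
      hS.toFinset J).card * F.step ^ (F.c + 2) = F.step * ν := by
    intro J hJ
    rw [Set.Finite.mem_toFinset] at hJ
    refine Eq.trans ?_ (c2 J hJ)
    rw [← Set.ncard_coe_finset]
    congr 2
    ext I
    simpa [Finset.bipartiteBelow, mem_scaledIdeals_comm F hx (e := 1)] using fun h => h2 J hJ h
  have e3 := congrArg (· * F.step ^ (F.c + 2)) hcount
  simp only [Finset.sum_mul] at e3
  rw [Finset.sum_congr rfl e2, Finset.sum_congr rfl (g := fun _ => ν * F.step ^ 2)
    (fun I hI => by rw [pow_add, ← mul_assoc, e1 I hI])] at e3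
  rw [Finset.sum_const, Finset.sum_const, smul_eq_mul, smul_eq_mul,
    ← Set.ncard_eq_toFinset_card _ hS, ← Set.ncard_eq_toFinset_card _ hS'] at e3
  have h5 : F.step * ν ≠ 0 := mul_ne_zero hQ.ne' hν0
  refine Nat.eq_of_mul_eq_mul_right (Nat.pos_of_ne_zero h5) ?_
  rw [← e3]
  ring

end Norm

end PoleFiltration

/-! ### The degree valuation on rational functions -/

section RationalFunctions

open Polynomial WithZero

variable {k : Type*} [Field k] [DecidableEq (RatFunc k)]

lemma inftyValuation_algebraMap {p : k[X]} (hp : p ≠ 0) :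
    RatFunc.inftyValuation k (algebraMap k[X] (RatFunc k) p) = exp (p.natDegree : ℤ) := by
  rw [RatFunc.inftyValuation_apply, RatFunc.inftyValuation.polynomial k hp]

lemma natDegree_lt_of_inftyValuation_lt {p : k[X]} {n : ℕ}
    (h : RatFunc.inftyValuation k (algebraMap k[X] (RatFunc k) p) < exp (n : ℤ)) :
    p = 0 ∨ p.natDegree < n := by
  by_cases hp : p = 0
  · exact Or.inl hp
  · rw [inftyValuation_algebraMap hp, exp_lt_exp] at h
    exact Or.inr (by exact_mod_cast h)

/-- Euclidean division of numerator by denominator: the remainder term has negative degree. -/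
lemma exists_inftyValuation_lt_one (r : RatFunc k) :
    ∃ p : k[X], RatFunc.inftyValuation k (r - algebraMap k[X] (RatFunc k) p) < exp 0 := by
  have hd : r.denom ≠ 0 := r.denom_ne_zero
  have hd' : algebraMap k[X] (RatFunc k) r.denom ≠ 0 := by simpa using hd
  refine ⟨r.num / r.denom, ?_⟩
  have h : r - algebraMap k[X] (RatFunc k) (r.num / r.denom) =
      algebraMap k[X] (RatFunc k) (r.num % r.denom) / algebraMap k[X] (RatFunc k) r.denom := by
    rw [eq_div_iff hd', sub_mul, ← (div_eq_iff hd').1 (RatFunc.num_div_denom r), ← map_mul,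
      ← map_sub, mul_comm, sub_eq_of_eq_add' (EuclideanDomain.div_add_mod r.num r.denom).symm]
  rw [h, map_div₀, inftyValuation_algebraMap hd]
  by_cases h0 : r.num % r.denom = 0
  · simp [h0]
  · rw [inftyValuation_algebraMap h0, ← exp_sub, exp_lt_exp]
    have := Polynomial.natDegree_lt_natDegree h0 (EuclideanDomain.mod_lt r.num hd)
    omega

end RationalFunctions

/-! ### The pole filtration of a finite extension of `k[X]` -/

section Construction

open Polynomial WithZero nonZeroDivisors

open scoped RatFunc in
/-- A finite extension of `k[X]` has a pole filtration, given by the degrees of coordinates. -/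
theorem exists_poleFiltration (k A K : Type*) [Field k] [Finite k] [CommRing A] [IsDomain A]
    [Algebra k[X] A] [Module.Finite k[X] A] [FaithfulSMul k[X] A] [Field K] [Algebra A K]
    [IsFractionRing A K] : Nonempty (PoleFiltration A K (algebraMap k[X] A X)) := by
  classical
  let : Algebra k[X] K := ((algebraMap A K).comp (algebraMap k[X] A)).toAlgebra
  have : IsScalarTower k[X] A K := IsScalarTower.of_algebraMap_eq fun _ => rfl
  have : FaithfulSMul k[X] K := (faithfulSMul_iff_algebraMap_injective _ _).2
    ((IsFractionRing.injective A K).comp (FaithfulSMul.algebraMap_injective k[X] A))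
  have : Module.IsTorsionFree k[X] A := inferInstance
  let ι := Module.Free.ChooseBasisIndex k[X] A
  let e : Module.Basis ι k[X] A := Module.Free.chooseBasis k[X] A
  let b : Module.Basis ι (RatFunc k) K := e.localizationLocalization (RatFunc k) k[X]⁰ K
  have hb : ∀ a i, b.repr (algebraMap A K a) i = algebraMap k[X] (RatFunc k) (e.repr a i) :=
    fun a i => e.localizationLocalization_repr_algebraMap (RatFunc k) k[X]⁰ K a i
  let v := RatFunc.inftyValuation k
  -- The defect `c` of multiplicativity bounds the degrees of the structure constants of the basis.
  obtain ⟨c, hc⟩ : ∃ c : ℕ, ∀ i j l, v (b.repr (b i * b j) l) ≤ exp (c : ℤ) := by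
    obtain ⟨c, hc⟩ := Finite.exists_le fun p : ι × ι × ι =>
      (log (v (b.repr (b p.1 * b p.2.1) p.2.2))).toNat
    refine ⟨c, fun i j l => le_exp_of_log_le ?_⟩
    have := hc (i, j, l)
    exact (Int.self_le_toNat _).trans (by exact_mod_cast this)
  have hX : ∀ y : K, algebraMap A K (algebraMap k[X] A X) * y = (RatFunc.X : RatFunc k) • y := by
    intro y
    rw [Algebra.smul_def, ← RatFunc.algebraMap_X, ← IsScalarTower.algebraMap_apply,
      ← IsScalarTower.algebraMap_apply]
  refine ⟨{
    -- The inequality is strict so that polynomial coordinates in `V_0` vanish and those in `V_1`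
    -- are constants; finiteness of `k` then makes `A ∩ V_1` finite.
    V := fun j =>
      { carrier := {y | ∀ i, v (b.repr y i) < exp j}
        zero_mem' := fun i => by simp
        add_mem' := fun {y z} hy hz i => by
          rw [map_add, Finsupp.add_apply]
          exact v.map_add_lt (hy i) (hz i)
        neg_mem' := fun {y} hy i => by
          rw [map_neg, Finsupp.neg_apply, v.map_neg]
          exact hy i }
    mono' := fun j y hy i => (hy i).trans (exp_lt_exp.2 (by omega))
    mem_iff' := fun j y => forall_congr' fun i => ?_
    c := c
    mul_mem := fun {m n y z} hy hz l => ?_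
    exists_mem := fun y => ?_
    eq_zero := fun a ha => ?_
    exists_sub_mem := fun y => ?_
    finite := ?_ }⟩
  · rw [hX, map_smul, Finsupp.smul_apply, smul_eq_mul, map_mul, RatFunc.inftyValuation.X,
      add_comm j 1, exp_add]
    exact (mul_lt_mul_iff_right₀ (by simp)).symm
  · have hexp : y * z = ∑ i, ∑ j, (b.repr y i * b.repr z j) • (b i * b j) := by
      conv_lhs => rw [← b.sum_repr y, ← b.sum_repr z, Finset.sum_mul_sum]
      refine Finset.sum_congr rfl fun i _ => Finset.sum_congr rfl fun j _ => ?_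
      rw [smul_mul_smul_comm]
    rw [hexp, map_sum, Finsupp.finsetSum_apply]
    refine v.map_sum_lt (by simp) fun i _ => ?_
    rw [map_sum, Finsupp.finsetSum_apply]
    refine v.map_sum_lt (by simp) fun j _ => ?_
    rw [map_smul, Finsupp.smul_apply, smul_eq_mul, map_mul, map_mul, exp_add, exp_add]
    refine lt_of_le_of_lt (mul_le_mul_right (hc i j l) _) ?_
    exact (mul_lt_mul_iff_left₀ (by simp)).2
      (mul_lt_mul'' (hy i) (hz j) zero_le zero_le)
  · obtain ⟨j, hj⟩ := Finite.exists_le fun i => log (v (b.repr y i))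
    exact ⟨j + 1, fun i => lt_of_le_of_lt (le_exp_of_log_le (hj i)) (exp_lt_exp.2 (by omega))⟩
  · refine e.repr.injective ?_
    ext1 i
    have := ha i
    rw [hb] at this
    simpa using natDegree_lt_of_inftyValuation_lt (n := 0) (by simpa using this)
  · choose p hp using fun i => exists_inftyValuation_lt_one (b.repr y i)
    refine ⟨∑ i, p i • e i, fun i => ?_⟩
    rw [map_sub, Finsupp.sub_apply, hb]
    simpa [Finsupp.single_apply] using hp i
  · refine (Set.finite_range fun g : ι → k => ∑ i, C (g i) • e i).subset fun a ha => ?_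
    refine ⟨fun i => (e.repr a i).coeff 0, ?_⟩
    conv_rhs => rw [← e.sum_repr a]
    refine Finset.sum_congr rfl fun i _ => ?_
    have := ha i
    rw [hb] at this
    congr 1
    rcases natDegree_lt_of_inftyValuation_lt (n := 1) (by simpa using this) with h | h
    · simp [h]
    · exact (eq_C_of_natDegree_eq_zero (by omega)).symm

end Construction

lemma PoleFiltration.one_lt_step {A K : Type*} [CommRing A] [Nontrivial A] [Field K] [Algebra A K]
    {x : A} (F : PoleFiltration A K x) (hx : algebraMap A K x ≠ 0) : 1 < F.step := by
  refine lt_of_le_of_ne (Nat.one_le_iff_ne_zero.2 F.step_ne_zero) fun h => ?_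
  obtain ⟨j, hj⟩ := F.exists_mem 1
  have h1 : F.V (j.toNat : ℤ) ≤ F.V 0 := by
    rw [← AddSubgroup.relIndex_eq_one, F.relIndex_eq hx j.toNat (by simp), ← h, one_pow]
  refine one_ne_zero (F.eq_zero 1 ?_)
  rw [map_one]
  exact h1 (F.mono (Int.self_le_toNat j) hj)

/-- The ideal `x A` is the unit ideal scaled by `x`, so its norm counts `A ∩ V_1`. When `A` is a
`k`-algebra, this shows that the step is a power of `q`. -/
lemma PoleFiltration.card_quotient_span {A K : Type*} [CommRing A] [IsDedekindDomain A] [Field K]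
    [Algebra A K] [IsFractionRing A K] {x : A} (F : PoleFiltration A K x)
    (hx : algebraMap A K x ≠ 0) : Nat.card (A ⧸ Ideal.span {x}) = F.step := by
  have hmem : Ideal.span {x} ∈ F.scaledIdeals 1 ⊤ := by
    refine ⟨1, by simp [IsOneUnit, (F.V _).zero_mem], ?_⟩
    rw [zpow_one, mul_one]
    refine ⟨fun i _ => ⟨x * i, ?_, by rw [map_mul]⟩, fun j hj => ?_⟩
    · exact Ideal.mul_mem_right _ _ (Ideal.mem_span_singleton_self x)
    · obtain ⟨i, rfl⟩ := Ideal.mem_span_singleton.1 hj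
      exact ⟨i, trivial, by rw [map_mul]⟩
  rw [F.card_quotient_of_mem_scaledIdeals hx top_ne_bot hmem, ← F.card_base_inf_V_one]
  have : invIdeal K (⊤ : Ideal A) = PoleFiltration.base A K := by
    ext b
    constructor
    · intro hb
      obtain ⟨a, ha⟩ := hb 1 trivial
      exact ⟨a, by simpa using ha.symm⟩
    · rintro ⟨a, rfl⟩
      exact algebraMap_mem_invIdeal _ a
  rw [this]

/-! ### Noether normalization and the recurrence for ideals -/

section Counting

open Polynomial

variable (k A : Type*) [Field k] [CommRing A] [IsDedekindDomain A] [Algebra k A]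
  [Algebra.FiniteType k A]

/-- Noether normalization in dimension one. -/
lemma exists_polynomial_algHom (hA : ¬ IsField A) :
    ∃ g : k[X] →ₐ[k] A, Function.Injective g ∧ g.Finite := by
  obtain ⟨s, g, hg, hfin⟩ := exists_finite_inj_algHom_of_fg k A
  have hs : s = 1 := by
    let := g.toRingHom.toAlgebra
    have hint : Algebra.IsIntegral (MvPolynomial (Fin s) k) A := ⟨hfin.to_isIntegral⟩
    have hinj : Function.Injective (algebraMap (MvPolynomial (Fin s) k) A) := hg
    have hle : s ≤ 1 := by
      -- A nonzero prime lifts to a nonzero prime of `A` by integrality; that prime is maximal,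
      -- hence so is its contraction.
      have h1 : Ring.KrullDimLE 1 (MvPolynomial (Fin s) k) := by
        rw [Ring.krullDimLE_one_iff_of_noZeroDivisors]
        intro p hp0 hp
        obtain ⟨Q, hQ, rfl⟩ := Ideal.exists_ideal_over_prime_of_isIntegral_of_isDomain (S := A) p
          (by rw [(RingHom.injective_iff_ker_eq_bot _).1 hinj]; exact bot_le)
        have hQ0 : Q ≠ ⊥ := by
          rintro rfl
          exact hp0 ((RingHom.injective_iff_ker_eq_bot _).1 hinj)
        have := hQ.isMaximal hQ0
        exact Ideal.isMaximal_comap_of_isIntegral_of_isMaximal Q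
      have h2 := Order.krullDimLE_iff _ _ |>.1 h1
      have h3 : ringKrullDim (MvPolynomial (Fin s) k) = s := by
        rw [MvPolynomial.ringKrullDim_of_isNoetherianRing, ringKrullDim_eq_zero_of_field]
        simp
      rw [← ringKrullDim, h3] at h2
      exact_mod_cast h2
    rcases Nat.le_one_iff_eq_zero_or_eq_one.1 hle with rfl | h
    · refine absurd ?_ hA
      refine (Algebra.IsIntegral.isField_iff_isField hinj).1 ?_
      exact (MvPolynomial.isEmptyRingEquiv k (Fin 0)).toMulEquiv.isField (Field.toIsField k)
    · exact h
  subst hs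
  refine ⟨g.comp (MvPolynomial.uniqueAlgEquiv k (Fin 1)).symm.toAlgHom, ?_, ?_⟩
  · exact hg.comp (MvPolynomial.uniqueAlgEquiv k (Fin 1)).symm.injective
  · exact hfin.comp (AlgHom.Finite.of_surjective _
      (MvPolynomial.uniqueAlgEquiv k (Fin 1)).symm.surjective)

variable [Finite k]

theorem exists_ncard_idealsOfNorm_pow (hA : ¬ IsField A) :
    (∀ I : Ideal A, I ≠ ⊥ → Finite (A ⧸ I)) ∧ (∀ ν, (idealsOfNorm A ν).Finite) ∧
    ∃ m n₀ : ℕ, 0 < m ∧ ∀ n, n₀ ≤ n →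
      (idealsOfNorm A (Nat.card k ^ (n + m))).ncard =
        Nat.card k ^ m * (idealsOfNorm A (Nat.card k ^ n)).ncard := by
  obtain ⟨g, hg, hfin⟩ := exists_polynomial_algHom k A hA
  let := g.toRingHom.toAlgebra
  have : Module.Finite k[X] A := hfin
  have : FaithfulSMul k[X] A := (faithfulSMul_iff_algebraMap_injective _ _).2 hg
  obtain ⟨F⟩ := exists_poleFiltration k A (FractionRing A)
  set x := algebraMap k[X] A X with hx
  have hx0 : algebraMap A (FractionRing A) x ≠ 0 := by
    have h : x ≠ 0 := by
      rw [hx, Ne, FaithfulSMul.algebraMap_eq_zero_iff]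
      exact X_ne_zero
    simpa using h
  have hinj : Function.Injective fun n : ℕ => x ^ n := by
    intro i j hij
    have : (X : k[X]) ^ i = X ^ j := FaithfulSMul.algebraMap_injective k[X] A (by simpa using hij)
    simpa using congrArg natDegree this
  have hquot : ∀ I : Ideal A, I ≠ ⊥ → Finite (A ⧸ I) := fun I hI => F.finite_quotient hx0 hI
  refine ⟨hquot, F.finite_idealsOfNorm hx0 hinj, ?_⟩
  have hspan : Ideal.span {x} ≠ (⊥ : Ideal A) := by
    rw [Ne, Ideal.span_singleton_eq_bot]
    rintro h
    rw [h, map_zero] at hx0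
    exact hx0 rfl
  have := hquot _ hspan
  have hstep : F.step = Nat.card k ^ Module.finrank k (A ⧸ Ideal.span {x}) := by
    rw [← F.card_quotient_span hx0]
    exact Module.natCard_eq_pow_finrank
  obtain ⟨T, hT⟩ := F.exists_ncard_idealsOfNorm hx0 hinj
  have hq : 1 < Nat.card k := Finite.one_lt_card
  -- The threshold `T + 1` works because `q^n > n`.
  refine ⟨Module.finrank k (A ⧸ Ideal.span {x}), T + 1, ?_, fun n hn => ?_⟩
  · rw [Nat.pos_iff_ne_zero]
    intro h
    have := F.one_lt_step hx0
    rw [hstep, h, pow_zero] at this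
    exact lt_irrefl _ this
  · have := hT (Nat.card k ^ n) (lt_of_lt_of_le (by omega) (Nat.lt_pow_self hq).le)
    rw [hstep, ← pow_add, add_comm] at this
    exact this

end Counting

/-! ### Ideals as effective divisors -/

section Factorization

open IsDedekindDomain

variable {A : Type*} [CommRing A] [IsDedekindDomain A]

/-- Multiplicativity of the norm of ideals. -/
lemma card_quotient_mul [Infinite A] (I J : Ideal A) :
    Nat.card (A ⧸ (I * J)) = Nat.card (A ⧸ I) * Nat.card (A ⧸ J) := by
  have := UniqueFactorizationMonoid.multiplicative_of_coprime (Submodule.cardQuot (M := A)) I J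
    -- Infinitude of `A` gives the zero ideal norm `0`, as multiplicativity requires.
    (Submodule.cardQuot_bot _ _)
    (fun {I J} hI => by simp [Ideal.isUnit_iff.mp hI, Ideal.mul_top])
    (fun {I} i hI =>
      have : Ideal.IsPrime I := Ideal.isPrime_of_prime hI
      cardQuot_pow_of_prime hI.ne_zero)
    fun {I J} hIJ => cardQuot_mul_of_coprime <| Ideal.isCoprime_iff_sup_eq.mpr
      (Ideal.isUnit_iff.mp
        (hIJ (Ideal.dvd_iff_le.mpr le_sup_left) (Ideal.dvd_iff_le.mpr le_sup_right)))
  simpa [Submodule.cardQuot_apply] using this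

lemma card_quotient_multiset_prod [Infinite A] (s : Multiset (Ideal A)) :
    Nat.card (A ⧸ s.prod) = (s.map fun I => Nat.card (A ⧸ I)).prod := by
  induction s using Multiset.induction with
  | empty =>
    have : Subsingleton (A ⧸ (1 : Ideal A)) := Ideal.Quotient.subsingleton_iff.2 Ideal.one_eq_top
    simp
  | cons I s ih => rw [Multiset.prod_cons, card_quotient_mul, ih, Multiset.map_cons,
      Multiset.prod_cons]

/-- The ideal of an effective divisor on the spectrum of a Dedekind domain. -/
noncomputable def divisorIdeal (D : HeightOneSpectrum A →₀ ℕ) : Ideal A :=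
  ((Finsupp.toMultiset D).map HeightOneSpectrum.asIdeal).prod

lemma card_quotient_divisorIdeal [Infinite A] (D : HeightOneSpectrum A →₀ ℕ) :
    Nat.card (A ⧸ divisorIdeal D) = D.prod fun P n => Nat.card (A ⧸ P.asIdeal) ^ n := by
  rw [divisorIdeal, card_quotient_multiset_prod, Multiset.map_map, Finsupp.toMultiset_map,
    Finsupp.prod_toMultiset, Finsupp.prod_mapDomain_index (by simp) (fun _ _ _ => pow_add _ _ _)]
  rfl

lemma prime_of_mem_map {s : Multiset (HeightOneSpectrum A)} {I : Ideal A}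
    (hI : I ∈ s.map HeightOneSpectrum.asIdeal) : Prime I := by
  obtain ⟨P, _, rfl⟩ := Multiset.mem_map.1 hI
  exact P.prime

lemma divisorIdeal_injective : Function.Injective (divisorIdeal (A := A)) := by
  intro D E h
  have h2 := congrArg UniqueFactorizationMonoid.normalizedFactors h
  rw [divisorIdeal, divisorIdeal,
    UniqueFactorizationMonoid.normalizedFactors_prod_of_prime fun _ => prime_of_mem_map,
    UniqueFactorizationMonoid.normalizedFactors_prod_of_prime fun _ => prime_of_mem_map] at h2
  classical
  refine Finsupp.orderIsoMultiset.injective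
    (Multiset.map_injective (fun _ _ h => HeightOneSpectrum.ext h) h2)

lemma divisorIdeal_ne_bot (D : HeightOneSpectrum A →₀ ℕ) : divisorIdeal D ≠ ⊥ := by
  refine Multiset.prod_ne_zero fun h => ?_
  exact (prime_of_mem_map h).ne_zero rfl

lemma exists_divisorIdeal_eq {I : Ideal A} (hI : I ≠ ⊥) :
    ∃ D : HeightOneSpectrum A →₀ ℕ, divisorIdeal D = I := by
  classical
  have h : ∀ J : {J // J ∈ UniqueFactorizationMonoid.normalizedFactors I},
      ∃ P : HeightOneSpectrum A, P.asIdeal = J.1 := fun J =>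
    have hp := UniqueFactorizationMonoid.prime_of_normalized_factor J.1 J.2
    ⟨⟨J, Ideal.isPrime_of_prime hp, hp.ne_zero⟩, rfl⟩
  choose g hg using h
  refine ⟨Multiset.toFinsupp ((UniqueFactorizationMonoid.normalizedFactors I).attach.map g), ?_⟩
  rw [divisorIdeal, Multiset.toFinsupp_toMultiset, Multiset.map_map,
    Multiset.map_congr (f := HeightOneSpectrum.asIdeal ∘ g) (g := Subtype.val) rfl fun J _ => hg J, Multiset.attach_map_val]
  exact associated_iff_eq.1 (UniqueFactorizationMonoid.prod_normalizedFactors hI)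

end Factorization

/-! ### The recurrence for divisors on an affine curve -/

section Degrees

/-- The degree of a divisor with respect to given degrees of points. -/
def weightedDegree {α : Type*} (d : α → ℕ) (D : α →₀ ℕ) : ℕ := D.sum fun P n => n * d P

open IsDedekindDomain

/-- The number of effective divisors of degree `n` on the spectrum of `A`. -/
theorem exists_ncard_weightedDegree (k A : Type*) [Field k] [Finite k] [CommRing A]
    [IsDedekindDomain A] [Algebra k A] [Algebra.FiniteType k A] (hA : ¬ IsField A)
    (d : HeightOneSpectrum A → ℕ) (hd : ∀ P, Nat.card (A ⧸ P.asIdeal) = Nat.card k ^ d P) :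
    (∀ n, {D | weightedDegree d D = n}.Finite) ∧ ∃ m n₀ : ℕ, 0 < m ∧ ∀ n, n₀ ≤ n →
      {D | weightedDegree d D = n + m}.ncard =
        Nat.card k ^ m * {D | weightedDegree d D = n}.ncard := by
  obtain ⟨-, hfin, m, n₀, hm, h⟩ := exists_ncard_idealsOfNorm_pow k A hA
  have : Infinite A := by
    by_contra hinf
    rw [not_infinite_iff_finite] at hinf
    exact hA (Finite.isField_of_domain A)
  have hq : 1 < Nat.card k := Finite.one_lt_card
  have hcard : ∀ D : HeightOneSpectrum A →₀ ℕ,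
      Nat.card (A ⧸ divisorIdeal D) = Nat.card k ^ weightedDegree d D := by
    intro D
    rw [card_quotient_divisorIdeal, weightedDegree, Finsupp.sum, ← Finset.prod_pow_eq_pow_sum]
    refine Finset.prod_congr rfl fun P _ => ?_
    simp only
    rw [hd, ← pow_mul, mul_comm]
  have himg : ∀ n, idealsOfNorm A (Nat.card k ^ n) =
      divisorIdeal '' {D | weightedDegree d D = n} := by
    intro n
    ext I
    constructor
    · rintro ⟨hI, hc⟩
      obtain ⟨D, rfl⟩ := exists_divisorIdeal_eq hI
      exact ⟨D, Nat.pow_right_injective hq ((hcard D).symm.trans hc), rfl⟩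
    · rintro ⟨D, hD, rfl⟩
      exact ⟨divisorIdeal_ne_bot D, by rw [hcard, hD]⟩
  refine ⟨fun n => ?_, m, n₀, hm, fun n hn => ?_⟩
  · have := hfin (Nat.card k ^ n)
    rw [himg] at this
    exact this.of_finite_image divisorIdeal_injective.injOn
  · have := h n hn
    rwa [himg, himg, Set.ncard_image_of_injective _ divisorIdeal_injective,
      Set.ncard_image_of_injective _ divisorIdeal_injective] at this

end Degrees

/-! ### Generating series of recurrent sequences -/

section GeneratingSeries

variable {T : Type*} (δ : T → ℕ) (q : ℕ)

lemma exists_le_pow_of_recurrence (a : ℕ → ℕ) {m n₀ : ℕ} (hm : 0 < m) (hq : 0 < q)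
    (h : ∀ n, n₀ ≤ n → a (n + m) = q ^ m * a n) : ∃ C, ∀ n, a n ≤ C * q ^ n := by
  refine ⟨∑ i ∈ Finset.range (n₀ + m), a i, fun n => ?_⟩
  induction n using Nat.strong_induction_on with
  | _ n ih =>
    by_cases hn : n < n₀ + m
    · exact (Finset.single_le_sum (f := a) (fun _ _ => Nat.zero_le _) (Finset.mem_range.2 hn)).trans
        (Nat.le_mul_of_pos_right _ (pow_pos hq n))
    · obtain ⟨l, rfl⟩ : ∃ l, n = l + m := ⟨n - m, by omega⟩
      rw [h l (by omega), pow_add, mul_comm (q ^ m), ← mul_assoc]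
      exact Nat.mul_le_mul_right _ (ih l (by omega))

variable (hfin : ∀ n, {D | δ D = n}.Finite)
include hfin

lemma tsum_fiber {R : Type*} [NormedRing R] (t : R) (n : ℕ) :
    HasSum (fun D : {D // δ D = n} => t ^ δ D.1) ({D | δ D = n}.ncard * t ^ n) := by
  have : Finite {D // δ D = n} := (hfin n).to_subtype
  have := Fintype.ofFinite {D // δ D = n}
  have h : {D | δ D = n}.ncard * t ^ n = ∑ D : {D // δ D = n}, t ^ δ D.1 := by
    rw [Finset.sum_congr rfl fun D _ => by rw [D.2], Finset.sum_const, nsmul_eq_mul,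
      ← Nat.card_coe_set_eq, Finset.card_univ, ← Nat.card_eq_fintype_card]
    rfl
  rw [h]
  exact hasSum_fintype _

lemma summable_pow_of_le {C : ℕ} (hC : ∀ n, {D | δ D = n}.ncard ≤ C * q ^ n) {r : ℝ} (hr : 0 ≤ r)
    (hqr : q * r < 1) : Summable fun D => r ^ δ D := by
  rw [← (Equiv.sigmaFiberEquiv δ).summable_iff]
  refine (summable_sigma_of_nonneg fun x => by simp; positivity).2 ⟨fun n => ?_, ?_⟩
  · exact (tsum_fiber δ hfin r n).summable
  · refine Summable.of_nonneg_of_le (fun n => tsum_nonneg fun D => ?_) (fun n => ?_)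
      ((summable_geometric_of_lt_one (by positivity) hqr).mul_left (C : ℝ))
    · exact pow_nonneg hr _
    · refine (tsum_fiber δ hfin r n).tsum_eq.le.trans ?_
      rw [mul_pow, ← mul_assoc]
      gcongr
      exact_mod_cast hC n

lemma tsum_pow_eq {t : ℂ} (ht : Summable fun D => ‖t‖ ^ δ D) :
    HasSum (fun n => ({D | δ D = n}.ncard : ℂ) * t ^ n) (∑' D, t ^ δ D) := by
  have hs : Summable fun D => t ^ δ D := Summable.of_norm (by simpa using ht)
  have h := (Equiv.sigmaFiberEquiv δ).hasSum_iff.2 hs.hasSum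
  exact h.sigma fun n => tsum_fiber δ hfin t n

/-- The generating series of a sequence with `a (n + m) = q ^ m a n` for large `n`
has at most a simple pole at `1 / q`. -/
theorem exists_tendsto_generatingSeries (hq : 1 < q) {m n₀ : ℕ} (hm : 0 < m)
    (h : ∀ n, n₀ ≤ n → {D | δ D = n + m}.ncard = q ^ m * {D | δ D = n}.ncard) :
    (∀ r : ℝ, 0 ≤ r → q * r < 1 → Summable fun D => r ^ δ D) ∧
    ∃ L, Tendsto (fun t : ℂ => (1 - q * t) * ∑' D, t ^ δ D) (𝓝[{t | q * ‖t‖ < 1}] (q : ℂ)⁻¹)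
      (𝓝 L) := by
  set a : ℕ → ℕ := fun n => {D | δ D = n}.ncard with ha
  obtain ⟨C, hC⟩ := exists_le_pow_of_recurrence q a hm (by omega) h
  have hs : ∀ r : ℝ, 0 ≤ r → q * r < 1 → Summable fun D => r ^ δ D :=
    fun r hr hqr => summable_pow_of_le δ q hfin hC hr hqr
  refine ⟨hs, ?_⟩
  -- The recurrence makes `P` equal to `(1 - (qt)^m)` times the series. Since `1 - (qt)^m = (1 - qt)
  -- S(t)` and `S(1/q) = m ≠ 0`, the limit is `P/S` at `1/q`.
  let P : ℂ → ℂ := fun t => ∑ n ∈ Finset.range (n₀ + m), (a n : ℂ) * t ^ n -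
    (q * t) ^ m * ∑ n ∈ Finset.range n₀, (a n : ℂ) * t ^ n
  let S : ℂ → ℂ := fun t => ∑ i ∈ Finset.range m, (q * t) ^ i
  have hq0 : (q : ℂ) ≠ 0 := by
    have : q ≠ 0 := by omega
    exact_mod_cast this
  have hPc : Continuous P := by fun_prop
  have hSc : Continuous S := by fun_prop
  have hS : S (q : ℂ)⁻¹ ≠ 0 := by
    simp only [S, mul_inv_cancel₀ hq0, one_pow, Finset.sum_const, Finset.card_range, nsmul_eq_mul,
      mul_one]
    exact_mod_cast hm.ne'
  refine ⟨P (q : ℂ)⁻¹ / S (q : ℂ)⁻¹, Tendsto.congr' ?_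
    ((hPc.continuousAt.div hSc.continuousAt hS).tendsto.mono_left nhdsWithin_le_nhds)⟩
  filter_upwards [self_mem_nhdsWithin] with t ht
  have ht : (q : ℝ) * ‖t‖ < 1 := ht
  have hsum := tsum_pow_eq δ hfin (hs ‖t‖ (norm_nonneg t) ht)
  set Z := ∑' D, t ^ δ D
  have e1 := hsum.summable.sum_add_tsum_nat_add (n₀ + m)
  have e2 := hsum.summable.sum_add_tsum_nat_add n₀
  have e3 : ∑' i, (a (i + (n₀ + m)) : ℂ) * t ^ (i + (n₀ + m)) =
      (q * t) ^ m * ∑' i, (a (i + n₀) : ℂ) * t ^ (i + n₀) := by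
    rw [← tsum_mul_left]
    refine tsum_congr fun i => ?_
    rw [← add_assoc, ha]
    simp only
    rw [h (i + n₀) (by omega)]
    push_cast
    ring
  rw [hsum.tsum_eq] at e1 e2
  have e4 : (1 - (q * t) ^ m) * Z = P t := by
    rw [e3] at e1
    simp only [P, ha] at e1 ⊢
    linear_combination -e1 + (q * t) ^ m * e2
  have hne : (1 - (q * t) ^ m) ≠ 0 := by
    intro h0
    have : ‖(q * t) ^ m‖ < 1 := by
      rw [norm_pow, norm_mul, Complex.norm_natCast]
      exact pow_lt_one₀ (by positivity) ht hm.ne'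
    rw [← sub_eq_zero.1 h0] at this
    simp at this
  have hgeom : (1 - q * t) * S t = 1 - (q * t) ^ m := mul_neg_geom_sum _ _
  have hSt : S t ≠ 0 := fun h0 => hne (by rw [← hgeom, h0, mul_zero])
  rw [Pi.div_apply, div_eq_iff hSt, ← e4, ← hgeom]
  ring

end GeneratingSeries

/-! ### Divisors supported on finitely many points -/

section FiniteProduct

lemma summable_prod_pow (γ : Type*) [Fintype γ] : ∀ x : γ → ℝ, (∀ i, 0 ≤ x i) →
    (∀ i, x i < 1) → Summable fun n : γ → ℕ => ∏ i, x i ^ n i := by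
  refine Fintype.induction_empty_option (P := fun γ _ => ∀ x : γ → ℝ, (∀ i, 0 ≤ x i) →
    (∀ i, x i < 1) → Summable fun n : γ → ℕ => ∏ i, x i ^ n i) ?_ ?_ ?_ γ
  · intro α β _ e ih x h0 h1
    let := Fintype.ofEquiv β e.symm
    rw [← (Equiv.piCongrLeft (fun _ => ℕ) e).summable_iff]
    convert ih (x ∘ e) (fun i => h0 _) (fun i => h1 _) using 2 with n
    simp only [Function.comp_apply]
    rw [← e.prod_comp]
    refine Finset.prod_congr rfl fun i _ => ?_
    rw [Equiv.piCongrLeft_apply_apply]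
  · intro x _ _
    exact (hasSum_fintype _).summable
  · intro α _ ih x h0 h1
    rw [← (Equiv.piOptionEquivProd (β := fun _ : Option α => ℕ)).symm.summable_iff]
    have h := (summable_geometric_of_lt_one (h0 none) (h1 none)).mul_of_nonneg
      (ih (fun i => x (some i)) (fun i => h0 _) fun i => h1 _)
      (fun n => pow_nonneg (h0 _) n) fun n => Finset.prod_nonneg fun i _ => pow_nonneg (h0 _) _
    convert h using 2 with n
    simp [Fintype.prod_option, Equiv.piOptionEquivProd]

variable {γ : Type*} [Finite γ] {d : γ → ℕ}

lemma summable_pow_weightedDegree (hd : ∀ i, 0 < d i) {r : ℝ} (h0 : 0 ≤ r) (h1 : r < 1) :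
    Summable fun D : γ →₀ ℕ => r ^ weightedDegree d D := by
  have := Fintype.ofFinite γ
  rw [← Finsupp.equivFunOnFinite.symm.summable_iff]
  convert summable_prod_pow γ (fun i => r ^ d i) (fun i => pow_nonneg h0 _)
    (fun i => pow_lt_one₀ h0 h1 (hd i).ne') using 2 with n
  simp only [Function.comp_apply, weightedDegree]
  rw [Finsupp.sum_fintype _ _ (by simp), ← Finset.prod_pow_eq_pow_sum]
  refine Finset.prod_congr rfl fun i _ => ?_
  rw [← pow_mul, mul_comm]
  rfl

/-- The series converges uniformly on closed discs of radius less than `1`. It is applied at `1/q`,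
where adding finitely many points therefore creates no pole. -/
lemma continuousAt_tsum_pow (hd : ∀ i, 0 < d i) {t₀ : ℂ} (ht : ‖t₀‖ < 1) :
    ContinuousAt (fun t : ℂ => ∑' D : γ →₀ ℕ, t ^ weightedDegree d D) t₀ := by
  obtain ⟨r, hr, hr1⟩ := exists_between ht
  have h : ContinuousOn (fun t : ℂ => ∑' D : γ →₀ ℕ, t ^ weightedDegree d D)
      (Metric.closedBall 0 r) := by
    refine continuousOn_tsum (fun D => by fun_prop)
      (summable_pow_weightedDegree hd ((norm_nonneg _).trans hr.le) hr1) fun D t ht => ?_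
    rw [norm_pow]
    exact pow_le_pow_left₀ (norm_nonneg _) (by simpa using ht) _
  refine h.continuousAt (Filter.mem_of_superset (Metric.isOpen_ball.mem_nhds ?_)
    Metric.ball_subset_closedBall)
  simpa using hr

end FiniteProduct

/-! ### Adding finitely many points -/

section Combination

/-- The generating series of effective divisors on the union of a set of points with good
generating series and finitely many further points. -/
theorem exists_tendsto_of_sum {α β γ : Type*} [Finite γ] (e : β ⊕ γ ≃ α) (d : α → ℕ)
    (hd : ∀ i, 0 < d i) {q : ℕ} (hq : 1 < q)
    (hfin : ∀ n, {D | weightedDegree (fun i => d (e (Sum.inl i))) D = n}.Finite)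
    {m n₀ : ℕ} (hm : 0 < m)
    (h : ∀ n, n₀ ≤ n → {D | weightedDegree (fun i => d (e (Sum.inl i))) D = n + m}.ncard =
      q ^ m * {D | weightedDegree (fun i => d (e (Sum.inl i))) D = n}.ncard) :
    (∀ r : ℝ, 0 ≤ r → q * r < 1 → Summable fun D => r ^ weightedDegree d D) ∧
    ∃ L, Tendsto (fun t : ℂ => (1 - q * t) * ∑' D, t ^ weightedDegree d D)
      (𝓝[{t | q * ‖t‖ < 1}] (q : ℂ)⁻¹) (𝓝 L) := by
  set d₁ : β → ℕ := fun i => d (e (Sum.inl i)) with hd₁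
  set d₂ : γ → ℕ := fun i => d (e (Sum.inr i)) with hd₂
  obtain ⟨hs₁, L, hL⟩ := exists_tendsto_generatingSeries (weightedDegree d₁) q hfin hq hm h
  have hq1 : (1 : ℝ) < q := by exact_mod_cast hq
  have hlt : ∀ {r : ℝ}, 0 ≤ r → q * r < 1 → r < 1 := fun hr hqr => by nlinarith
  let E : (β →₀ ℕ) × (γ →₀ ℕ) ≃ (α →₀ ℕ) :=
    Finsupp.sumFinsuppEquivProdFinsupp.symm.trans (Finsupp.domCongr e).toEquiv
  have hE : ∀ p, weightedDegree d (E p) = weightedDegree d₁ p.1 + weightedDegree d₂ p.2 := by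
    rintro ⟨D₁, D₂⟩
    have h1 : E (D₁, D₂) = Finsupp.equivMapDomain e (Finsupp.sumElim D₁ D₂) := rfl
    rw [h1, weightedDegree, Finsupp.sum_equivMapDomain]
    exact Finsupp.sum_sumElim D₁ D₂ _
  refine ⟨fun r hr hqr => ?_, ?_⟩
  · rw [← E.summable_iff]
    have h1 : Summable fun D => r ^ weightedDegree d₁ D := hs₁ r hr hqr
    have h2 : Summable fun D => r ^ weightedDegree d₂ D :=
      summable_pow_weightedDegree (fun i => hd _) hr (hlt hr hqr)
    have h1' : 0 ≤ fun D => r ^ weightedDegree d₁ D := fun D => pow_nonneg hr _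
    have h2' : 0 ≤ fun D => r ^ weightedDegree d₂ D := fun D => pow_nonneg hr _
    refine (h1.mul_of_nonneg h2 h1' h2').congr fun p => ?_
    rw [Function.comp_apply, hE, pow_add]
  · have hc := (continuousAt_tsum_pow (d := d₂) (fun i => hd _) (t₀ := (q : ℂ)⁻¹) (by
      rw [norm_inv, Complex.norm_natCast]
      exact inv_lt_one_of_one_lt₀ hq1)).tendsto.mono_left
        (nhdsWithin_le_nhds (s := {t | q * ‖t‖ < 1}))
    refine ⟨_, Tendsto.congr' ?_ (hL.mul hc)⟩
    filter_upwards [self_mem_nhdsWithin] with t ht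
    have ht : (q : ℝ) * ‖t‖ < 1 := ht
    have h1 : Summable fun D => ‖t ^ weightedDegree d₁ D‖ := by
      simpa using hs₁ _ (norm_nonneg t) ht
    have h2 : Summable fun D => ‖t ^ weightedDegree d₂ D‖ := by
      simpa using summable_pow_weightedDegree (fun i => hd _) (norm_nonneg t)
        (hlt (norm_nonneg t) ht)
    rw [mul_assoc, tsum_mul_tsum_of_summable_norm h1 h2, ← E.tsum_eq]
    simp only [hE, pow_add]

end Combination

/-! ### Topology of one-dimensional spaces -/

section DimensionOne

/-- In a one-dimensional space, chains of irreducible closed subsets have length at most one. -/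
lemma not_lt_of_lt_of_topologicalKrullDim {X : Type*} [TopologicalSpace X]
    (h : topologicalKrullDim X = 1) {a b c : TopologicalSpace.IrreducibleCloseds X} (hab : a < b) :
    ¬ b < c := by
  intro hbc
  let s : LTSeries (TopologicalSpace.IrreducibleCloseds X) :=
    { length := 2
      toFun := ![a, b, c]
      step := fun i => by fin_cases i <;> simpa }
  have h1 := Order.LTSeries.length_le_krullDim s
  rw [← topologicalKrullDim, h] at h1
  have h2 : (2 : ℕ) ≤ 1 := by exact_mod_cast h1
  omega

lemma exists_lt_of_topologicalKrullDim {X : Type*} [TopologicalSpace X]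
    (h : topologicalKrullDim X = 1) : ∃ a b : TopologicalSpace.IrreducibleCloseds X, a < b := by
  by_contra! hcon
  have : topologicalKrullDim X ≤ 0 := by
    refine iSup_le fun s => ?_
    by_contra hs
    have hs' : s.length ≠ 0 := by
      intro h0
      exact hs (by simp [h0])
    exact hcon (s 0) (s (Fin.last _)) (s.strictMono (Fin.pos_iff_ne_zero.2 (by
      simpa [Fin.ext_iff] using hs')))
  rw [h] at this
  exact absurd this (by decide)

/-- Decompose the complement of `U` into finitely many irreducible closed sets `t`. A closed point
in `t` must be all of `t`, since otherwise `{P} < t < X` is a chain of length two. -/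
lemma finite_closed_points_of_notMem {X : Type*} [TopologicalSpace X]
    [TopologicalSpace.NoetherianSpace X] [IrreducibleSpace X] (h : topologicalKrullDim X = 1)
    {U : Set X} (hU : IsOpen U) (hne : U.Nonempty) : {P | IsClosed {P} ∧ P ∉ U}.Finite := by
  obtain ⟨S, hS, hcl, hirr, hun⟩ :=
    TopologicalSpace.NoetherianSpace.exists_finite_set_isClosed_irreducible hU.isClosed_compl
  refine Set.Finite.of_finite_image (f := fun P => ({P} : Set X)) (hS.subset ?_)
    Set.singleton_injective.injOn
  rintro _ ⟨P, ⟨hP, hPU⟩, rfl⟩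
  have hP' : P ∈ ⋃₀ S := by rw [← hun]; exact hPU
  obtain ⟨t, htS, hPt⟩ := hP'
  have ht : t ⊆ Uᶜ := by rw [hun]; exact Set.subset_sUnion_of_mem htS
  by_cases heq : {P} = t
  · rw [← heq] at htS; exact htS
  · exfalso
    refine not_lt_of_lt_of_topologicalKrullDim h (a := ⟨{P}, isIrreducible_singleton, hP⟩)
      (b := ⟨t, hirr t htS, hcl t htS⟩)
      (c := ⟨Set.univ, IrreducibleSpace.isIrreducible_univ X, isClosed_univ⟩) ?_ ?_
    · exact lt_of_le_of_ne (Set.singleton_subset_iff.2 hPt) fun e => heq (congrArg (·.carrier) e)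
    · refine lt_of_le_of_ne (Set.subset_univ _) fun e => ?_
      have e' : t = Set.univ := congrArg (·.carrier) e
      obtain ⟨x, hx⟩ := hne
      exact ht (e' ▸ Set.mem_univ x) hx

end DimensionOne

/-! ### Residue fields at closed points -/

section Affine

variable {k : Type u} [Field k] {X : Scheme.{u}} (f : X ⟶ Spec (CommRingCat.of k))

lemma finiteType_scalars [LocallyOfFiniteType f] {U : X.Opens} (hU : IsAffineOpen U) :
    (scalars f U).FiniteType := by
  have h := f.finiteType_appLE (isAffineOpen_top (Spec (CommRingCat.of k))) hU le_top
  have h2 := h.comp (RingHom.FiniteType.of_surjective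
    (Scheme.ΓSpecIso (CommRingCat.of k)).inv.hom
    (Scheme.ΓSpecIso (CommRingCat.of k)).symm.commRingCatIsoToRingEquiv.surjective)
  convert h2
  simp only [scalars, Scheme.Hom.appLE]
  rfl

lemma natCard_residueField_spec (x : Spec (CommRingCat.of k)) :
    Nat.card ((Spec (CommRingCat.of k)).residueField x) = Nat.card k := by
  have e := (Scheme.Spec.residueFieldIso (CommRingCat.of k) x).commRingCatIsoToRingEquiv
  rw [Nat.card_congr e.toEquiv]
  have hbot : x.asIdeal = ⊥ := (Ideal.eq_bot_or_top x.asIdeal).resolve_right x.isPrime.ne_top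
  have hmax : x.asIdeal.IsMaximal := by rw [hbot]; exact Ideal.bot_isMaximal
  have h := Ideal.bijective_algebraMap_quotient_residueField x.asIdeal
  refine (Nat.card_congr ((Equiv.ofBijective _ h).symm.trans ?_))
  exact ((Ideal.quotEquivOfEq hbot).trans (RingEquiv.quotientBot k)).toEquiv

lemma natCard_residueField {U : X.Opens} (hU : IsAffineOpen U) (x : U)
    (hx : (hU.primeIdealOf x).asIdeal.IsMaximal) :
    Nat.card (X.residueField x.1) = Nat.card (Γ(X, U) ⧸ (hU.primeIdealOf x).asIdeal) := by
  have := hU.isLocalization_stalk x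
  exact Nat.card_congr (IsLocalization.AtPrime.equivQuotMaximalIdeal
    (hU.primeIdealOf x).asIdeal (X.presheaf.stalk x.1)).symm.toEquiv

variable [Finite k]

/-- By the Nullstellensatz the residue field is finite over `k`, so its cardinality is `q` to its
degree. `residueDegree` is taken over the residue field of the image point of `Spec k`, which has
`q` elements. -/
lemma natCard_quotient [LocallyOfFiniteType f] {U : X.Opens} (hU : IsAffineOpen U) (x : U)
    (hx : (hU.primeIdealOf x).asIdeal.IsMaximal) :
    Nat.card (Γ(X, U) ⧸ (hU.primeIdealOf x).asIdeal) = Nat.card k ^ f.residueDegree x.1 ∧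
      0 < f.residueDegree x.1 := by
  have hft := finiteType_scalars f hU
  let := (scalars f U).toAlgebra
  have : Algebra.FiniteType k Γ(X, U) := hft
  let := Ideal.Quotient.field (hU.primeIdealOf x).asIdeal
  have : Module.Finite k (Γ(X, U) ⧸ (hU.primeIdealOf x).asIdeal) :=
    finite_of_finite_type_of_isJacobsonRing _ _
  have hfin : Finite (Γ(X, U) ⧸ (hU.primeIdealOf x).asIdeal) := Module.finite_of_finite k
  have hcard := natCard_residueField hU x hx
  have : Finite (X.residueField x.1) := Nat.finite_of_card_ne_zero (by
    rw [hcard]; exact Nat.card_pos.ne')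
  let := (f.residueFieldMap x.1).hom.toAlgebra
  have : Module.Finite ((Spec (CommRingCat.of k)).residueField (f x.1)) (X.residueField x.1) :=
    Module.Finite.of_finite
  refine ⟨?_, ?_⟩
  · rw [← hcard, Module.natCard_eq_pow_finrank
      (K := (Spec (CommRingCat.of k)).residueField (f x.1)), natCard_residueField_spec]
    rfl
  · exact Module.finrank_pos

end Affine

/-! ### Affine opens of the curve are Dedekind -/

section Dedekind

lemma isDiscreteValuationRing_of_isRegularLocalRing (R : Type*) [CommRing R] [IsDomain R]
    [IsRegularLocalRing R] (hdim : ringKrullDim R ≤ 1) (hR : ¬ IsField R) :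
    IsDiscreteValuationRing R := by
  have h := (IsRegularLocalRing.iff_finrank_cotangentSpace R).1 inferInstance
  rw [← h] at hdim
  have hle : Module.finrank (IsLocalRing.ResidueField R) (IsLocalRing.CotangentSpace R) ≤ 1 := by
    exact_mod_cast hdim
  have h1 := ((tfae_of_isNoetherianRing_of_isLocalRing_of_isDomain R).out 5 4).1 hle
  exact ((IsDiscreteValuationRing.TFAE R hR).out 4 0).1 h1

variable {X : Scheme.{u}}

lemma exists_primeIdealOf_eq {U : X.Opens} (hU : IsAffineOpen U) (P : PrimeSpectrum Γ(X, U)) :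
    ∃ x : U, hU.primeIdealOf x = P := by
  have hmem : hU.fromSpec P ∈ U := by
    have : hU.fromSpec P ∈ Set.range hU.fromSpec := ⟨_, rfl⟩
    rwa [hU.range_fromSpec] at this
  exact ⟨⟨_, hmem⟩, hU.fromSpec.isOpenEmbedding.injective (hU.fromSpec_primeIdealOf ⟨_, hmem⟩)⟩

/-- Take an affine neighbourhood `U` of a point `x` of the smaller set in a chain `a < b`. If its
ring were a field, then `U = {x}`, and `b`, being the closure of `b ∩ U`, would lie in `a`. -/
lemma exists_isAffineOpen_not_isField [IsIntegral X] (hdim : topologicalKrullDim X = 1) :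
    ∃ (U : X.Opens) (_ : IsAffineOpen U), Nonempty U ∧ ¬ IsField Γ(X, U) := by
  obtain ⟨a, b, hab⟩ := exists_lt_of_topologicalKrullDim hdim
  obtain ⟨x, hx⟩ := a.isIrreducible.nonempty
  obtain ⟨U, hU, hxU, -⟩ := exists_isAffineOpen_mem_and_subset (TopologicalSpace.Opens.mem_top x)
  refine ⟨U, hU, ⟨x, hxU⟩, fun hfield => hab.not_ge ?_⟩
  have hsub : ∀ y ∈ U, y = x := by
    intro y hy
    have h : hU.primeIdealOf ⟨y, hy⟩ = hU.primeIdealOf ⟨x, hxU⟩ := by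
      let := hfield.toField
      exact Subsingleton.elim _ _
    have := congrArg hU.fromSpec h
    rwa [hU.fromSpec_primeIdealOf, hU.fromSpec_primeIdealOf] at this
  have hbU : (b : Set X) ⊆ closure (b ∩ U) :=
    subset_closure_inter_of_isPreirreducible_of_isOpen b.isIrreducible.isPreirreducible U.2
      ⟨x, hab.le hx, hxU⟩
  refine hbU.trans (closure_minimal ?_ a.isClosed)
  rintro y ⟨-, hy⟩
  rw [hsub y hy]
  exact hx

lemma isDedekindDomain_of_isAffineOpen [IsIntegral X] [IsLocallyNoetherian X]
    (hreg : ∀ x : X, IsRegularLocalRing (X.presheaf.stalk x)) (hdim : topologicalKrullDim X = 1)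
    {U : X.Opens} (hU : IsAffineOpen U) [Nonempty U] : IsDedekindDomain Γ(X, U) := by
  have : IsNoetherianRing Γ(X, U) := IsLocallyNoetherian.component_noetherian ⟨U, hU⟩
  have hdimA : ringKrullDim Γ(X, U) ≤ 1 := by
    rw [← PrimeSpectrum.topologicalKrullDim_eq_ringKrullDim, ← hdim]
    exact hU.fromSpec.isOpenEmbedding.isInducing.topologicalKrullDim_le
  have : IsDedekindDomainDvr Γ(X, U) :=
    { is_dvr_at_nonzero_prime := fun P hP0 hP => by
        obtain ⟨x, hx⟩ := exists_primeIdealOf_eq hU ⟨P, hP⟩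
        obtain rfl : (hU.primeIdealOf x).asIdeal = P := congrArg PrimeSpectrum.asIdeal hx
        have := hU.isLocalization_stalk x
        have e := (IsLocalization.algEquiv (hU.primeIdealOf x).asIdeal.primeCompl
          (X.presheaf.stalk x.1)
          (Localization.AtPrime (hU.primeIdealOf x).asIdeal)).toRingEquiv
        have := hreg x.1
        have := IsRegularLocalRing.of_ringEquiv e
        refine isDiscreteValuationRing_of_isRegularLocalRing _ ?_
          (IsLocalization.AtPrime.not_isField _ hP0 _)
        rw [IsLocalization.AtPrime.ringKrullDim_eq_height (hU.primeIdealOf x).asIdeal]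
        exact (Ideal.height_le_ringKrullDim_of_ne_top hP.ne_top).trans hdimA }
  infer_instance

/-- The closed points of an affine open subset `U`, together with the closed points not in `U`. -/
lemma exists_equiv_closedPoint [JacobsonSpace X] {U : X.Opens} (hU : IsAffineOpen U)
    [IsDedekindDomain Γ(X, U)] (hfield : ¬ IsField Γ(X, U)) :
    ∃ e : IsDedekindDomain.HeightOneSpectrum Γ(X, U) ⊕ {P : ClosedPoint X // P.1 ∉ U} ≃
      ClosedPoint X, ∀ P, ∃ x : U, (hU.primeIdealOf x).asIdeal = P.asIdeal ∧
        (e (Sum.inl P)).1 = x.1 := by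
  have h : ∀ P : IsDedekindDomain.HeightOneSpectrum Γ(X, U), ∃ x : U,
      hU.primeIdealOf x = ⟨P.asIdeal, P.isPrime⟩ := fun P => exists_primeIdealOf_eq hU _
  choose g hg using h
  have hcl : ∀ P, IsClosed {(g P).1} := by
    intro P
    have hmax : (hU.primeIdealOf (g P)).asIdeal.IsMaximal := by
      rw [hg]
      exact P.isMaximal
    have h1 : hU.primeIdealOf (g P) ∈ closedPoints (PrimeSpectrum Γ(X, U)) :=
      (PrimeSpectrum.isClosed_singleton_iff_isMaximal _).2 hmax
    -- This is where the Jacobson property enters: a point closed in `U` is closed in `X`.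
    have h2 := hU.fromSpec.isOpenEmbedding.preimage_closedPoints
    have h3 : hU.fromSpec (hU.primeIdealOf (g P)) ∈ closedPoints X := (Set.ext_iff.1 h2 _).2 h1
    rw [hU.fromSpec_primeIdealOf] at h3
    exact h3
  let φ : IsDedekindDomain.HeightOneSpectrum Γ(X, U) ⊕ {P : ClosedPoint X // P.1 ∉ U} →
    ClosedPoint X := Sum.elim (fun P => ⟨(g P).1, hcl P⟩) Subtype.val
  have hφ : Function.Bijective φ := by
    constructor
    · rintro (P | P) (Q | Q) hPQ
      · have h1 : g P = g Q := Subtype.ext (congrArg (fun p : ClosedPoint X => p.1) hPQ)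
        have h2 := (hg P).symm.trans ((congrArg hU.primeIdealOf h1).trans (hg Q))
        exact congrArg Sum.inl (IsDedekindDomain.HeightOneSpectrum.ext
          (congrArg PrimeSpectrum.asIdeal h2))
      · have h1 : (g P).1 = Q.1.1 := congrArg (fun p : ClosedPoint X => p.1) hPQ
        exact absurd (h1 ▸ (g P).2) Q.2
      · have h1 : (g Q).1 = P.1.1 := congrArg (fun p : ClosedPoint X => p.1) hPQ.symm
        exact absurd (h1 ▸ (g Q).2) P.2
      · exact congrArg Sum.inr (Subtype.ext hPQ)
    · rintro P
      by_cases hP : P.1 ∈ U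
      · have hmax := hU.primeIdealOf_isMaximal_of_isClosed ⟨P.1, hP⟩ P.2
        let Q : IsDedekindDomain.HeightOneSpectrum Γ(X, U) :=
          ⟨(hU.primeIdealOf ⟨P.1, hP⟩).asIdeal, hmax.isPrime, fun h0 =>
            hfield (Ring.isField_iff_maximal_bot.2 (h0 ▸ hmax))⟩
        refine ⟨Sum.inl Q, Subtype.ext ?_⟩
        have := congrArg hU.fromSpec (hg Q)
        rw [hU.fromSpec_primeIdealOf] at this
        exact this.trans (hU.fromSpec_primeIdealOf ⟨P.1, hP⟩)
      · exact ⟨Sum.inr ⟨P, hP⟩, rfl⟩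
  exact ⟨Equiv.ofBijective φ hφ, fun P => ⟨g P, congrArg PrimeSpectrum.asIdeal (hg P), rfl⟩⟩

end Dedekind

/-- The generating series of effective divisors converges, with at most a simple pole at `1/q`. -/
theorem exists_tendsto_divisorDegree {k : Type u} [Field k] [Finite k] {X : Scheme.{u}}
    (f : X ⟶ Spec (CommRingCat.of k)) (hX : IsRegularProjectiveCurve f) :
    (∀ P, 0 < pointDegree f P) ∧
    (∀ r : ℝ, 0 ≤ r → Nat.card k * r < 1 → Summable fun D => r ^ divisorDegree f D) ∧
    ∃ L, Tendsto (fun t : ℂ => (1 - Nat.card k * t) * ∑' D, t ^ divisorDegree f D)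
      (𝓝[{t | Nat.card k * ‖t‖ < 1}] (Nat.card k : ℂ)⁻¹) (𝓝 L) := by
  have := hX.isIntegral
  have := hX.isProper
  have hdim := hX.dim_eq_one
  have : JacobsonSpace X := LocallyOfFiniteType.jacobsonSpace f
  have : IsLocallyNoetherian X := LocallyOfFiniteType.isLocallyNoetherian f
  have : CompactSpace X := QuasiCompact.compactSpace_of_compactSpace f
  have : IsNoetherian X := {}
  have hpos : ∀ P, 0 < pointDegree f P := by
    intro P
    obtain ⟨U, hU, hPU, -⟩ := exists_isAffineOpen_mem_and_subset (TopologicalSpace.Opens.mem_top P.1)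
    exact (natCard_quotient f hU ⟨P.1, hPU⟩
      (hU.primeIdealOf_isMaximal_of_isClosed ⟨P.1, hPU⟩ P.2)).2
  obtain ⟨U, hU, hne, hfield⟩ := exists_isAffineOpen_not_isField (X := X) hdim
  have := isDedekindDomain_of_isAffineOpen hX.isRegular hdim hU
  obtain ⟨e, he⟩ := exists_equiv_closedPoint hU hfield
  let := (scalars f U).toAlgebra
  have : Algebra.FiniteType k Γ(X, U) := finiteType_scalars f hU
  have : Finite {P : ClosedPoint X // P.1 ∉ U} := by
    have h := finite_closed_points_of_notMem hdim U.2 (by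
      obtain ⟨x⟩ := hne
      exact ⟨x.1, x.2⟩)
    have := h.to_subtype
    exact Finite.of_injective (fun P : {P : ClosedPoint X // P.1 ∉ U} =>
      (⟨P.1.1, P.1.2, P.2⟩ : {P : X | IsClosed {P} ∧ P ∉ (U : Set X)}))
      fun P Q h => Subtype.ext (Subtype.ext (Subtype.mk.inj h))
  obtain ⟨hfin, m, n₀, hm, hrec⟩ := exists_ncard_weightedDegree k Γ(X, U) hfield
    (fun P => pointDegree f (e (Sum.inl P))) (fun P => by
      obtain ⟨x, hx, hxe⟩ := he P
      rw [pointDegree, hxe, ← hx]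
      exact (natCard_quotient f hU x (by rw [hx]; exact P.isMaximal)).1)
  exact ⟨hpos, exists_tendsto_of_sum e (pointDegree f) hpos Finite.one_lt_card hfin hm hrec⟩

/-! ### Convergence, the value at one, and growth -/

/-- A product of factors `1 + O(c ^ j)` with `0 ≤ c < 1` is bounded. -/
lemma exists_prod_norm_le {S c : ℝ} (hS : 0 ≤ S) (hc : 0 ≤ c) (hc1 : c < 1) {z : ℕ → ℂ}
    (hz : ∀ j, 2 ≤ j → ‖z j‖ ≤ 1 + S * c ^ (j - 2)) :
    ∃ C, ∀ n, ∏ j ∈ Finset.Icc 2 n, ‖z j‖ ≤ C := by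
  refine ⟨Real.exp (S * (1 - c)⁻¹), fun n => ?_⟩
  calc ∏ j ∈ Finset.Icc 2 n, ‖z j‖ ≤ ∏ j ∈ Finset.Icc 2 n, Real.exp (S * c ^ (j - 2)) :=
        Finset.prod_le_prod (fun _ _ => norm_nonneg _) fun j hj =>
          (hz j (Finset.mem_Icc.1 hj).1).trans
            ((add_comm _ _).trans_le (Real.add_one_le_exp _))
    _ = Real.exp (S * ∑ j ∈ Finset.Icc 2 n, c ^ (j - 2)) := by
        rw [← Real.exp_sum, Finset.mul_sum]
    _ ≤ _ := by
        refine Real.exp_le_exp.2 (mul_le_mul_of_nonneg_left ?_ hS)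
        rw [← tsum_geometric_of_lt_one hc hc1]
        have h := (summable_geometric_of_lt_one hc hc1).sum_le_tsum
          ((Finset.Icc 2 n).image (· - 2)) fun _ _ => pow_nonneg hc _
        rwa [Finset.sum_image fun a ha b hb hab => by
          have h1 := (Finset.mem_Icc.1 ha).1
          have h2 := (Finset.mem_Icc.1 hb).1
          have h3 : a - 2 = b - 2 := hab
          omega] at h

/-- The factor `q^(-a)` compensates for the absent index `j = 1`. -/
lemma prod_rpow_Icc {q a : ℝ} (hq : 0 < q) {n : ℕ} (hn : 1 ≤ n) :
    ∏ j ∈ Finset.Icc 2 n, q ^ (a * (j : ℝ)) = q ^ (-a) * q ^ (a * n * (n + 1) / 2) := by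
  induction n, hn using Nat.le_induction with
  | base =>
    rw [← Real.rpow_add hq]
    norm_num
  | succ n hn ih =>
    rw [Finset.prod_Icc_succ_top (by omega), ih, mul_assoc, ← Real.rpow_add hq]
    congr 2
    push_cast
    ring

variable {k : Type u} [Field k] {X : Scheme.{u}} (f : X ⟶ Spec (CommRingCat.of k))

lemma one_div_divisorNorm_cpow (D : EffectiveDivisor X) (s : ℂ) :
    1 / (divisorNorm f D : ℂ) ^ s = ((Nat.card k : ℂ) ^ (-s)) ^ divisorDegree f D := by
  rw [divisorNorm, ← Complex.cpow_nat_mul, Nat.cast_pow, one_div, ← Complex.cpow_neg,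
    Complex.natCast_cpow_natCast_mul]

lemma zeta_eq_tsum (s : ℂ) :
    zeta f s = ∑' D, ((Nat.card k : ℂ) ^ (-s)) ^ divisorDegree f D :=
  tsum_congr fun D => one_div_divisorNorm_cpow f D s

variable [Finite k]

lemma norm_natCard_cpow_neg (s : ℂ) : ‖(Nat.card k : ℂ) ^ (-s)‖ = (Nat.card k : ℝ) ^ (-s.re) := by
  rw [Complex.norm_natCast_cpow_of_pos Nat.card_pos, Complex.neg_re]

lemma natCard_mul_rpow_lt_one {x : ℝ} (hx : 1 < x) :
    (Nat.card k : ℝ) * (Nat.card k : ℝ) ^ (-x) < 1 := by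
  have h1 : (1 : ℝ) < Nat.card k := by exact_mod_cast Finite.one_lt_card
  have h0 : (0 : ℝ) < Nat.card k := by linarith
  calc (Nat.card k : ℝ) * (Nat.card k : ℝ) ^ (-x) = (Nat.card k : ℝ) ^ (1 - x) := by
        rw [sub_eq_add_neg, Real.rpow_add h0, Real.rpow_one]
    _ < 1 := Real.rpow_lt_one_of_one_lt_of_neg h1 (by linarith)

variable (hX : IsRegularProjectiveCurve f)
include hX

lemma summable_one_div_divisorNorm {s : ℂ} (hs : 1 < s.re) :
    Summable fun D : EffectiveDivisor X => 1 / (divisorNorm f D : ℂ) ^ s := by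
  refine Summable.of_norm ?_
  simp only [one_div_divisorNorm_cpow, norm_pow, norm_natCard_cpow_neg]
  exact (exists_tendsto_divisorDegree f hX).2.1 _ (by positivity) (natCard_mul_rpow_lt_one hs)

lemma tendsto_regularizedZeta :
    Tendsto (regularizedZeta f) (𝓝[{s : ℂ | 1 < s.re}] 1) (𝓝 (completedZetaStar f)) := by
  obtain ⟨-, -, L, hL⟩ := exists_tendsto_divisorDegree f hX
  have hq0 : (Nat.card k : ℂ) ≠ 0 := Nat.cast_ne_zero.2 Nat.card_pos.ne'
  have hcont : Continuous fun s : ℂ => (Nat.card k : ℂ) ^ (-s) :=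
    continuous_neg.const_cpow (Or.inl hq0)
  have h1 : Tendsto (fun s : ℂ => (Nat.card k : ℂ) ^ (-s)) (𝓝[{s : ℂ | 1 < s.re}] 1)
      (𝓝 (Nat.card k : ℂ)⁻¹) := by
    have := (hcont.tendsto 1).mono_left (nhdsWithin_le_nhds (s := {s : ℂ | 1 < s.re}))
    rwa [Complex.cpow_neg_one] at this
  have h2 : Tendsto (fun s : ℂ => (Nat.card k : ℂ) ^ (-s)) (𝓝[{s : ℂ | 1 < s.re}] 1)
      (𝓝[{t | Nat.card k * ‖t‖ < 1}] (Nat.card k : ℂ)⁻¹) := by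
    refine tendsto_nhdsWithin_iff.2 ⟨h1, ?_⟩
    filter_upwards [self_mem_nhdsWithin] with s hs
    rw [norm_natCard_cpow_neg]
    exact natCard_mul_rpow_lt_one hs
  -- Since `completedZetaStar` is a `limUnder`, existence of some limit suffices; `t = q^{-s}` maps
  -- the half-plane into `|t| < 1/q`.
  refine tendsto_nhds_limUnder ⟨(Nat.card k : ℂ)⁻¹ ^ (1 - (genus f : ℤ)) * L, ?_⟩
  refine ((h1.zpow₀ _ (Or.inl (inv_ne_zero hq0))).mul (hL.comp h2)).congr fun s => ?_
  rw [Function.comp_apply, regularizedZeta, completedZeta, zeta_eq_tsum, sub_eq_add_neg 1 s,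
    Complex.cpow_add _ _ hq0, Complex.cpow_one]
  ring

/-- The zero divisor contributes `1`. Any other `D` has degree `d ≥ 1`, so `q^{-jd} ≤ q^{-2d}
q^{-(j-2)}`, and the sum of `q^{-2d}` over all divisors serves as `S`. -/
lemma exists_norm_zeta_natCast_le :
    ∃ S : ℝ, 0 ≤ S ∧ ∀ j : ℕ, 2 ≤ j →
      ‖zeta f j‖ ≤ 1 + S * (Nat.card k : ℝ)⁻¹ ^ (j - 2) := by
  classical
  obtain ⟨hpos, hsum, -⟩ := exists_tendsto_divisorDegree f hX
  have hq1 : (1 : ℝ) < Nat.card k := by exact_mod_cast Finite.one_lt_card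
  set c : ℝ := (Nat.card k : ℝ)⁻¹ with hc
  have hc0 : 0 ≤ c := by positivity
  have hc1 : c ≤ 1 := inv_le_one_of_one_le₀ hq1.le
  have hS : Summable fun D => (c ^ 2) ^ divisorDegree f D := by
    refine hsum _ (by positivity) ?_
    rw [hc, sq, ← mul_assoc, mul_inv_cancel₀ (by positivity), one_mul]
    exact inv_lt_one_of_one_lt₀ hq1
  refine ⟨∑' D, (c ^ 2) ^ divisorDegree f D, tsum_nonneg fun _ => by positivity, fun j hj => ?_⟩
  have hle : ∀ D : EffectiveDivisor X, ‖((Nat.card k : ℂ) ^ (-(j : ℂ))) ^ divisorDegree f D‖ ≤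
      (if D = 0 then 1 else 0) + (c ^ 2) ^ divisorDegree f D * c ^ (j - 2) := by
    intro D
    rw [norm_pow, norm_natCard_cpow_neg, Complex.natCast_re, Real.rpow_neg (by positivity),
      Real.rpow_natCast, ← inv_pow, ← hc]
    split_ifs with hD
    · exact (pow_le_one₀ (by positivity) (pow_le_one₀ hc0 hc1)).trans
        (le_add_of_nonneg_right (by positivity))
    · have hdeg : divisorDegree f D ≠ 0 := by
        intro h0
        obtain ⟨P, hP⟩ := Finsupp.ne_iff.1 hD
        have := (Finset.sum_eq_zero_iff.1 h0) P (Finsupp.mem_support_iff.2 hP)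
        exact (mul_ne_zero hP (hpos P).ne') this
      rw [zero_add]
      calc (c ^ j) ^ divisorDegree f D
          = (c ^ 2) ^ divisorDegree f D * (c ^ (j - 2)) ^ divisorDegree f D := by
            rw [← mul_pow, ← pow_add, Nat.add_sub_cancel' hj]
        _ ≤ _ := mul_le_mul_of_nonneg_left
            (pow_le_of_le_one (by positivity) (pow_le_one₀ hc0 hc1) hdeg) (by positivity)
  rw [zeta_eq_tsum, ← tsum_mul_right]
  refine tsum_of_norm_bounded ?_ hle
  exact (hasSum_ite_eq 0 1).add (hS.mul_right _).hasSum

lemma isBigO_vHat :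
    vHat f =O[atTop]
      fun n : ℕ => (Nat.card k : ℝ) ^ (((genus f : ℝ) - 1) * n * (n + 1) / 2) := by
  have hq1 : (1 : ℝ) < Nat.card k := by exact_mod_cast Finite.one_lt_card
  have hq0 : (0 : ℝ) < Nat.card k := by linarith
  obtain ⟨S, hS, hz⟩ := exists_norm_zeta_natCast_le f hX
  obtain ⟨C, hC⟩ := exists_prod_norm_le hS (by positivity) (inv_lt_one_of_one_lt₀ hq1) hz
  have hnorm : ∀ j : ℕ, ‖completedZeta f j‖ =
      (Nat.card k : ℝ) ^ (((genus f : ℝ) - 1) * (j : ℝ)) * ‖zeta f j‖ := by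
    intro j
    rw [completedZeta, norm_mul, norm_zpow, norm_natCard_cpow_neg, Complex.natCast_re,
      ← Real.rpow_intCast, ← Real.rpow_mul hq0.le]
    congr 2
    push_cast
    ring
  refine IsBigO.of_bound
    (‖completedZetaStar f‖ * ((Nat.card k : ℝ) ^ (-((genus f : ℝ) - 1)) * C)) ?_
  filter_upwards [eventually_ge_atTop 1] with n hn
  rw [vHat, norm_mul, norm_prod, Finset.prod_congr rfl fun j _ => hnorm j,
    Finset.prod_mul_distrib, prod_rpow_Icc hq0 hn, Real.norm_of_nonneg (by positivity)]
  calc _ ≤ ‖completedZetaStar f‖ * ((Nat.card k : ℝ) ^ (-((genus f : ℝ) - 1)) *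
        (Nat.card k : ℝ) ^ (((genus f : ℝ) - 1) * n * (n + 1) / 2) * C) := by
        gcongr
        exact hC n
    _ = _ := by ring

end CurveZeta

theorem mainTheorem7 {k : Type u} [Field k] [Finite k] {X : Scheme.{u}}
    (f : X ⟶ Spec (CommRingCat.of k)) (hX : CurveZeta.IsRegularProjectiveCurve f) :
    (∀ s : ℂ, 1 < s.re →
      Summable fun D : CurveZeta.EffectiveDivisor X =>
        1 / (CurveZeta.divisorNorm f D : ℂ) ^ s) ∧
    Tendsto (CurveZeta.regularizedZeta f) (𝓝[{s : ℂ | 1 < s.re}] 1)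
      (𝓝 (CurveZeta.completedZetaStar f)) ∧
    (CurveZeta.vHat f) =O[atTop]
      fun n : ℕ => (Nat.card k : ℝ) ^ (((CurveZeta.genus f : ℝ) - 1) * n * (n + 1) / 2) := by
  exact ⟨fun s hs => CurveZeta.summable_one_div_divisorNorm f hX hs,
    CurveZeta.tendsto_regularizedZeta f hX, CurveZeta.isBigO_vHat f hX⟩
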